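/- Let $\mathbb S\subset\mathbb R^3$ be the unit sphere with surface measure $\mathrm d\xi=\sin\theta\,\mathrm d\theta\,\mathrm d\varphi$, and let $\mathbb H=L^2(\mathbb S;\mathbb C)$ with $\langle f,g\rangle=\int_{\mathbb S} f\,\overline g\,\mathrm d\xi$. Let $\mathbb H_\ell$ be the linear span of the spherical harmonics $Y_{\ell m}$, $-\ell\le m\le\ell$, and let $L_\ell=\frac{2\ell+1}{4\pi}P_\ell$, where $P_\ell$ is the Legendre polynomial of degree $\ell$ with $P_\ell(1)=1$. Let $\mathcal J$ be a countable set and, for each $j\in\mathcal J$, let $b^{(j)}=(b^{(j)}_\ell)_{\ell\in\mathbb N}$ be a real sequence with finite support; put $d^{(j)}=\max\{\ell: b^{(j)}_\ell\ne0\}$ (and $d^{(j)}=0$ if $b^{(j)}=0$). Assume that there are constants $C_1,C_2>0$ with $$C_1\le\sum_{j\in\mathcal J}|b^{(j)}_\ell|^2\le C_2\qquad\text{for all }\ell\in\mathbb N .$$ For each $j$ let $(\xi^{(j)}_k,\lambda^{(j)}_k)_{k\in K^{(j)}}$ be a finite family of points of $\mathbb S$ and weights $\lambda^{(j)}_k>0$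 that is an exact quadrature formula at degree $2d^{(j)}$, that is, $\int_{\mathbb S}F\,\mathrm d\xi=\sum_{k}\lambda^{(j)}_kF(\xi^{(j)}_k)$ for all $F\in\bigoplus_{\ell=0}^{2d^{(j)}}\mathbb H_\ell$. Define $$\tilde b^{(j)}_\ell=\frac{b^{(j)}_\ell}{\sum_{j'\in\mathcal J}(b^{(j')}_\ell)^2},\qquad \psi^{(j)}_k(\xi)=\sqrt{\lambda^{(j)}_k}\sum_{\ell=0}^{d^{(j)}}b^{(j)}_\ell L_\ell(\xi\cdot\xi^{(j)}_k),\qquad \tilde\psi^{(j)}_k(\xi)=\sqrt{\lambda^{(j)}_k}\sum_{\ell=0}^{d^{(j)}}\tilde b^{(j)}_\ell L_\ell(\xi\cdot\xi^{(j)}_k).$$ Then the family $(\psi^{(j)}_k)_{j\in\mathcal J,\,k\in K^{(j)}}$ is a frame of $\mathbb H$ with frame bounds $C_1$ and $C_2$, that is, $C_1\|X\|^2\le\sum_{j,k}|\langle X,\psi^{(j)}_k\rangle|^2\le C_2\|X\|^2$ for all $X\in\mathbb H$. Its (canonical) dual frame is the family $(\tilde\psi^{(j)}_k)$: the frame operator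 $SX=\sum_{j,k}\langle X,\psi^{(j)}_k\rangle\psi^{(j)}_k$ is bounded with bounded inverse and $\tilde\psi^{(j)}_k=S^{-1}\psi^{(j)}_k$. In particular, for every $X\in\mathbb H$, with $\beta^{(j)}_k=\langle X,\psi^{(j)}_k\rangle$ and $\tilde\beta^{(j)}_k=\langle X,\tilde\psi^{(j)}_k\rangle$, $$X=\sum_{j\in\mathcal J}\sum_{k\in K^{(j)}}\beta^{(j)}_k\,\tilde\psi^{(j)}_k\quad\text{in }\mathbb H,\qquad \|X\|^2=\sum_{j\in\mathcal J}\sum_{k\in K^{(j)}}\beta^{(j)}_k\,\overline{\tilde\beta^{(j)}_k},$$ both series converging unconditionally. -/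

import Mathlib

noncomputable section

namespace Needlet

open MeasureTheory Polynomial

/-! ### Frames in a complex Hilbert space

Mathlib's inner product is conjugate-linear in the first variable, so the scalar product
`⟨g, f⟩`, linear in `g`, is written `inner ℂ f g`. -/

section Frames

variable {H ι : Type*} [NormedAddCommGroup H] [InnerProductSpace ℂ H]

/-- The family `f` is a frame of `H` with frame bounds `A` and `B`:
`A ‖g‖² ≤ ∑ n, |⟨g, f n⟩|² ≤ B ‖g‖²` for every `g` (the series being convergent),
with positive `A` and `B`. -/
def IsFrame (f : ι → H) (A B : ℝ) : Prop :=
  0 < A ∧ 0 < B ∧ ∀ g : H,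
    Summable (fun n => ‖inner ℂ (f n) g‖ ^ 2) ∧
    A * ‖g‖ ^ 2 ≤ ∑' n, ‖inner ℂ (f n) g‖ ^ 2 ∧
    ∑' n, ‖inner ℂ (f n) g‖ ^ 2 ≤ B * ‖g‖ ^ 2

/-- The family `f'` is the (canonical) dual frame of `f`: the frame operator
`S g = ∑ n, ⟨g, f n⟩ f n` is a well-defined bounded operator with bounded inverse,
and `f' n = S⁻¹ (f n)` for every `n`. -/
def IsDualFrame (f f' : ι → H) : Prop :=
  ∃ S : H ≃L[ℂ] H,
    (∀ g : H, HasSum (fun n => inner ℂ (f n) g • f n) (S g)) ∧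
    ∀ n, f' n = S.symm (f n)

end Frames

/-! ### The sphere, Legendre polynomials and spherical harmonics -/

/-- The unit sphere of `ℝ³`. -/
abbrev Sphere : Type := Metric.sphere (0 : EuclideanSpace ℝ (Fin 3)) 1

/-- The surface measure `sin θ dθ dφ` of the unit sphere, of total mass `4π`. -/
abbrev sphereMeasure : Measure Sphere :=
  (volume : Measure (EuclideanSpace ℝ (Fin 3))).toSphere

/-- The Hilbert space of complex-valued square-integrable functions on the sphere. -/
abbrev SphereL2 : Type := Lp ℂ 2 sphereMeasure

/-- The Legendre polynomial `P_ℓ`, normalized by `P_ℓ(1) = 1`, by the formula of Rodrigues. -/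
def legendreP (ℓ : ℕ) : ℝ[X] :=
  C (((2 : ℝ) ^ ℓ * (ℓ.factorial : ℝ))⁻¹) * derivative^[ℓ] ((X ^ 2 - 1) ^ ℓ)

/-- `L_ℓ(t) = (2ℓ + 1) / (4π) * P_ℓ(t)`. -/
def legendreL (ℓ : ℕ) (t : ℝ) : ℝ :=
  (2 * (ℓ : ℝ) + 1) / (4 * Real.pi) * (legendreP ℓ).eval t

/-- The spherical harmonic `Y_{ℓ m}` of order `m ≥ 0` (for `m ≤ ℓ`), that is,
`√((2ℓ+1)/(4π) * (ℓ-m)!/(ℓ+m)!) * P_{ℓ m}(cos θ) * e^{i m φ}` with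
`P_{ℓ m}(t) = (-1)^m (1 - t²)^{m/2} (d/dt)^m P_ℓ(t)`. In Cartesian coordinates,
`cos θ = ξ₂` and `(1 - cos² θ)^{m/2} e^{i m φ} = (ξ₀ + i ξ₁)^m`. -/
def sphericalHarmonicNonneg (ℓ m : ℕ) (ξ : Sphere) : ℂ :=
  ((√((2 * (ℓ : ℝ) + 1) / (4 * Real.pi) *
      (((ℓ - m).factorial : ℝ) / ((ℓ + m).factorial : ℝ))) *
    ((-1) ^ m * (derivative^[m] (legendreP ℓ)).eval (ξ.1 2)) : ℝ) : ℂ) *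
    ((ξ.1 0 : ℂ) + (ξ.1 1 : ℂ) * Complex.I) ^ m

/-- The complex spherical harmonic `Y_{ℓ m}`, `-ℓ ≤ m ≤ ℓ`. For negative order,
`Y_{ℓ, -m} = (-1)^m * conj Y_{ℓ m}`. -/
def sphericalHarmonic (ℓ : ℕ) (m : ℤ) (ξ : Sphere) : ℂ :=
  if 0 ≤ m then sphericalHarmonicNonneg ℓ m.natAbs ξ
  else (-1) ^ m.natAbs * (starRingEnd ℂ) (sphericalHarmonicNonneg ℓ m.natAbs ξ)

/-- The harmonic space of degree `ℓ`: the linear span of `Y_{ℓ m}`, `-ℓ ≤ m ≤ ℓ`. -/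
def harmonicSpace (ℓ : ℕ) : Submodule ℂ (Sphere → ℂ) :=
  Submodule.span ℂ (sphericalHarmonic ℓ '' Set.Icc (-(ℓ : ℤ)) (ℓ : ℤ))

/-! ### Quadrature formulas and needlets -/

/-- The points `ξ k` and weights `w k` provide an exact quadrature formula at degree `N`:
`∫ F(ξ) dξ = ∑ k, w k * F(ξ k)` for every `F` in the sum of the harmonic spaces of
degree at most `N`. -/
def IsExactQuadrature {K : Type*} [Fintype K] (ξ : K → Sphere) (w : K → ℝ) (N : ℕ) : Prop :=
  ∀ F ∈ ⨆ ℓ ∈ Finset.range (N + 1), harmonicSpace ℓ,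
    ∫ η, F η ∂sphereMeasure = ∑ k, (w k : ℂ) * F (ξ k)

/-- The continuous function `ξ ↦ √w * ∑_{ℓ ≤ d} b ℓ * L_ℓ(ξ · η)` on the sphere. -/
def needletFun (d : ℕ) (b : ℕ → ℝ) (w : ℝ) (η : Sphere) : C(Sphere, ℂ) where
  toFun ξ := ((√w * ∑ ℓ ∈ Finset.range (d + 1),
    b ℓ * legendreL ℓ (inner ℝ (ξ : EuclideanSpace ℝ (Fin 3)) η) : ℝ) : ℂ)
  continuous_toFun := by
    unfold legendreL
    fun_prop

/-- The function `needletFun d b w η` as an element of the Hilbert space. -/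
def needletL2 (d : ℕ) (b : ℕ → ℝ) (w : ℝ) (η : Sphere) : SphereL2 :=
  ContinuousMap.toLp 2 sphereMeasure ℂ (needletFun d b w η)

section Windows

variable {J : Type*} {K : J → Type*}

/-- The largest multipole in the support of a window (`0` for the zero window). -/
def bandLimit (b : ℕ → ℝ) : ℕ := sSup {ℓ | b ℓ ≠ 0}

/-- The synthesis windows `b̃^{(j)}_ℓ = b^{(j)}_ℓ / ∑ j', (b^{(j')}_ℓ)²`. -/
def synthesisWindow (b : J → ℕ → ℝ) (j : J) (ℓ : ℕ) : ℝ :=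
  b j ℓ / ∑' j', (b j' ℓ) ^ 2

/-- The (decomposition) needlets
`ψ^{(j)}_k(ξ) = √λ^{(j)}_k * ∑_{ℓ ≤ d^{(j)}} b^{(j)}_ℓ L_ℓ(ξ · ξ^{(j)}_k)`. -/
def needlet (b : J → ℕ → ℝ) (ξ : ∀ j, K j → Sphere) (w : ∀ j, K j → ℝ)
    (i : Σ j, K j) : SphereL2 :=
  needletL2 (bandLimit (b i.1)) (b i.1) (w i.1 i.2) (ξ i.1 i.2)

/-- The reconstruction needlets
`ψ̃^{(j)}_k(ξ) = √λ^{(j)}_k * ∑_{ℓ ≤ d^{(j)}} b̃^{(j)}_ℓ L_ℓ(ξ · ξ^{(j)}_k)`. -/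
def reconstructionNeedlet (b : J → ℕ → ℝ) (ξ : ∀ j, K j → Sphere) (w : ∀ j, K j → ℝ)
    (i : Σ j, K j) : SphereL2 :=
  needletL2 (bandLimit (b i.1)) (synthesisWindow b i.1) (w i.1 i.2) (ξ i.1 i.2)

end Windows

end Needlet

end

/-!
Write `L_ℓ(· ζ)` for the zonal kernel `η ↦ L_ℓ(η · ζ)`. Two facts about these kernels carry the
proof.

* They reproduce each other: `∫ L_m(η · ξ) L_n(η · ζ) dη` is `L_n(ξ · ζ)` if `m = n` and `0`
  otherwise (`integral_legendreL_mul_legendreL`). The addition theorem for spherical harmonics is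
  not needed for this. The convolution of two zonal polynomials is a zonal polynomial whose degree
  is at most that of either factor (`exists_zonal_convolution`). Hence for `m ≤ n` the convolution
  of `P_m` and `P_n` is a polynomial of degree at most `n` in `ξ · ζ`; associativity of the
  convolution shows that it is orthogonal to all polynomials of smaller degree than `n`, so it is a
  multiple of `P_n`, and the factor is found at `ξ = ζ`. The integrals over the sphere come from
  Gaussian moments, and `∫ p(ζ · η) dη = 2π ∫ p(t) dt` is used through its values on derivatives.
* They are total in `L²` (`span_zonalL2_topologicalClosure`): their closed span in the continuous
  functions contains every power of every linear form, hence the exponentials `exp (η · v)`, which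
  span an algebra to which the Stone–Weierstrass theorem applies.

Every polynomial of degree at most `N` restricts to an element of the sum of the harmonic spaces of
degree at most `N` (`affineSpace_pow_le`), so a quadrature formula that is exact at degree `2d`
integrates `L_m(η · ξ) L_n(η · ζ)` exactly for `m, n ≤ d`. Consequently, for one window `b` the
partial frame operator `g ↦ ∑ k, ⟨g, ψ_k⟩ ψ_k` maps `L_m(· ζ)` to `(b m)² L_m(· ζ)`
(`sum_inner_needletL2_smul`). Expanding in a Hilbert basis of common eigenvectors gives the frame
bounds (`isFrame_of_eigenvectors`), and the frame operator `S` acts on `L_m(· ζ)` as the scalar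
`σ m = ∑ j, (b j m)²`. The reconstruction needlets are needlets for the windows `b j m / σ m`, so
they form a frame as well, with a frame operator `R` acting as `(σ m)⁻¹`. Thus `R = S⁻¹`, it maps
each needlet to its reconstruction needlet, and the expansions follow by applying `R` to the series
that defines `S F`.
-/

noncomputable section

namespace Needlet

open MeasureTheory Polynomial
open scoped Pointwise

local notation "⟪" x "," y "⟫" => inner ℝ (x : EuclideanSpace ℝ (Fin 3)) (y : EuclideanSpace ℝ (Fin 3))

/-! ### Legendre polynomials -/

/-- Only the term of Leibniz' formula in which `(X - a)^n` takes all derivatives survives at `a`. -/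
theorem eval_iterate_derivative_X_sub_C_pow_mul (a : ℝ) (n : ℕ) (q : ℝ[X]) :
    (derivative^[n] ((X - C a) ^ n * q)).eval a = n.factorial * q.eval a := by
  induction n generalizing q with
  | zero => simp
  | succ n ih =>
    have h : derivative ((X - C a) ^ (n + 1) * q) =
        (X - C a) ^ n * (C ((n : ℝ) + 1) * q + (X - C a) * derivative q) := by
      rw [derivative_mul, derivative_X_sub_C_pow]
      simp only [Nat.add_sub_cancel, Nat.cast_add, Nat.cast_one, map_add, map_natCast, map_one]
      ring
    rw [Function.iterate_succ_apply, h, ih]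
    simp [Nat.factorial_succ]
    ring

theorem eval_one_legendreP (n : ℕ) : (legendreP n).eval 1 = 1 := by
  have h : ((X : ℝ[X]) ^ 2 - 1) ^ n = (X - C 1) ^ n * (X + 1) ^ n := by
    rw [← mul_pow]; congr 1; simp only [map_one]; ring
  rw [legendreP, h, eval_mul, eval_iterate_derivative_X_sub_C_pow_mul]
  simp only [eval_C, eval_pow, eval_add, eval_X, eval_one]
  have : (n.factorial : ℝ) ≠ 0 := by positivity
  rw [one_add_one_eq_two]
  field_simp

theorem eval_neg_one_legendreP (n : ℕ) : (legendreP n).eval (-1) = (-1) ^ n := by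
  have h : ((X : ℝ[X]) ^ 2 - 1) ^ n = (X - C (-1)) ^ n * (X - 1) ^ n := by
    rw [← mul_pow]; congr 1; simp only [map_one, map_neg]; ring
  rw [legendreP, h, eval_mul, eval_iterate_derivative_X_sub_C_pow_mul]
  simp only [eval_C, eval_pow, eval_sub, eval_X, eval_one]
  have : (n.factorial : ℝ) ≠ 0 := by positivity
  rw [show (-1 - 1 : ℝ) = (-1) * 2 by norm_num, mul_pow]
  field_simp

theorem coeff_legendreP_ne_zero (n : ℕ) : (legendreP n).coeff n ≠ 0 := by
  have hc : (((X : ℝ[X]) ^ 2 - 1) ^ n).coeff (n + n) = 1 := by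
    have hm : (((X : ℝ[X]) ^ 2 - 1) ^ n).Monic := (monic_X_pow_sub_C (1 : ℝ) two_ne_zero).pow n
    have hd : (((X : ℝ[X]) ^ 2 - 1) ^ n).natDegree = n + n := by
      rw [natDegree_pow, ← C_1, natDegree_X_pow_sub_C]; ring
    have := hm.coeff_natDegree
    rwa [hd] at this
  rw [legendreP, coeff_C_mul, coeff_iterate_derivative, hc]
  refine mul_ne_zero (by positivity) ?_
  simp

theorem natDegree_legendreP (n : ℕ) : (legendreP n).natDegree = n := by
  refine natDegree_eq_of_le_of_coeff_ne_zero ?_ (coeff_legendreP_ne_zero n)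
  refine (natDegree_C_mul_le _ _).trans ((natDegree_iterate_derivative _ _).trans ?_)
  rw [natDegree_pow, ← C_1, natDegree_X_pow_sub_C]; omega

theorem legendreP_mem_degreeLT (n : ℕ) : legendreP n ∈ degreeLT ℝ (n + 1) := by
  rw [mem_degreeLT]
  refine degree_le_natDegree.trans_lt ?_
  rw [natDegree_legendreP]; exact_mod_cast n.lt_succ_self

/-- A subspace that contains one polynomial of each exact degree `k < N` contains all
polynomials of degree less than `N`. -/
theorem mem_of_forall_natDegree_eq {V : Submodule ℝ ℝ[X]} {N : ℕ}
    (h : ∀ k < N, ∃ q ∈ V, q.natDegree = k ∧ q.coeff k ≠ 0) :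
    ∀ p ∈ degreeLT ℝ N, p ∈ V := by
  induction N with
  | zero =>
    intro p hp
    have : p = 0 := by
      ext m
      exact (degree_lt_iff_coeff_zero _ _).1 (mem_degreeLT.1 hp) m m.zero_le
    simp [this]
  | succ N ih =>
    intro p hp
    obtain ⟨q, hq, hqd, hqc⟩ := h N N.lt_succ_self
    have hr : p - C (p.coeff N / q.coeff N) * q ∈ degreeLT ℝ N := by
      rw [mem_degreeLT, degree_lt_iff_coeff_zero]
      intro m hm
      rw [coeff_sub, coeff_C_mul]
      rcases hm.eq_or_lt with rfl | hm
      · field_simp; ring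
      · have h1 : p.coeff m = 0 :=
          (degree_lt_iff_coeff_zero _ _).1 (mem_degreeLT.1 hp) m hm
        rw [h1, coeff_eq_zero_of_natDegree_lt (by omega : q.natDegree < m)]; simp
    have := V.add_mem (ih (fun k hk => h k (by omega)) _ hr) (V.smul_mem (p.coeff N / q.coeff N) hq)
    rwa [smul_eq_C_mul, sub_add_cancel] at this

section Functional

variable {Λ : ℝ[X] →ₗ[ℝ] ℝ} {c : ℝ}

/-- `legendreP n` is orthogonal to all polynomials of degree less than `n` for the functional `Λ`,
which stands for a multiple of the integral over `[-1, 1]`. This follows from Rodrigues' formula by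
`n` integrations by parts, in which the boundary terms vanish. -/
theorem legendreP_orthogonal (hΛ : ∀ p, Λ (derivative p) = c * (p.eval 1 - p.eval (-1)))
    (n : ℕ) {q : ℝ[X]} (hq : q ∈ degreeLT ℝ n) : Λ (legendreP n * q) = 0 := by
  have key : ∀ k ≤ n, ∀ q ∈ degreeLT ℝ k,
      Λ (derivative^[k] (((X : ℝ[X]) ^ 2 - 1) ^ n) * q) = 0 := by
    intro k
    induction k with
    | zero =>
      intro _ q hq
      exact mem_of_forall_natDegree_eq (V := Λ.ker.comap
        (LinearMap.mulLeft ℝ (derivative^[0] (((X : ℝ[X]) ^ 2 - 1) ^ n))))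
        (by simp) q hq
    | succ k ih =>
      intro hk q hq
      have hq' : derivative q ∈ degreeLT ℝ k := by
        rw [mem_degreeLT, degree_lt_iff_coeff_zero] at hq ⊢
        intro m hm
        rw [coeff_derivative, hq (m + 1) (by omega), zero_mul]
      have h0 := ih (by omega) _ hq'
      obtain ⟨r, hr⟩ := pow_sub_dvd_iterate_derivative_pow ((X : ℝ[X]) ^ 2 - 1) n k
      have hb := hΛ (derivative^[k] (((X : ℝ[X]) ^ 2 - 1) ^ n) * q)
      rw [derivative_mul, map_add, h0, add_zero,
        ← Function.iterate_succ_apply' (f := ⇑(derivative (R := ℝ)))] at hb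
      rw [hb, hr]
      have : n - k ≠ 0 := by omega
      simp [this]
  have := key n le_rfl q hq
  rw [legendreP, mul_assoc, ← smul_eq_C_mul, map_smul, this, smul_zero]

/-- The normalization of the Legendre polynomials. The polynomial `X P_n' - n P_n` has degree less
than `n`, so `Λ (P_n X P_n') = n Λ (P_n²)`; the boundary values of `X P_n²` give the rest. -/
theorem legendreP_mul_self (hΛ : ∀ p, Λ (derivative p) = c * (p.eval 1 - p.eval (-1)))
    (n : ℕ) : (2 * (n : ℝ) + 1) * Λ (legendreP n * legendreP n) = 2 * c := by
  have hlow : X * derivative (legendreP n) - C (n : ℝ) * legendreP n ∈ degreeLT ℝ n := by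
    rw [mem_degreeLT, degree_lt_iff_coeff_zero]
    intro m hm
    have h1 : (X * derivative (legendreP n)).coeff m = m * (legendreP n).coeff m := by
      cases m with
      | zero => simp
      | succ m => rw [coeff_X_mul, coeff_derivative]; push_cast; ring
    rw [coeff_sub, coeff_C_mul, h1]
    rcases hm.eq_or_lt with rfl | hm
    · ring
    · rw [coeff_eq_zero_of_natDegree_lt (by rw [natDegree_legendreP]; exact hm)]; simp
  have h1 := legendreP_orthogonal hΛ n hlow
  have h2 := hΛ (X * (legendreP n * legendreP n))
  have h3 : derivative (X * (legendreP n * legendreP n)) =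
      legendreP n * legendreP n + (2 : ℝ) • (legendreP n *
        (X * derivative (legendreP n) - C (n : ℝ) * legendreP n)) +
        (2 * (n : ℝ)) • (legendreP n * legendreP n) := by
    simp only [derivative_mul, derivative_X, smul_eq_C_mul, map_mul, C_ofNat]
    ring
  rw [h3, map_add, map_add, map_smul, map_smul, h1] at h2
  simp only [eval_mul, eval_X, eval_one_legendreP, eval_neg_one_legendreP, smul_eq_mul] at h2
  rw [← mul_pow] at h2
  norm_num at h2
  linarith

end Functional

/-! ### Integration of zonal functions over the sphere -/

/-- The Gaussian moment `∫ x^k e^{-x²} dx` over the line. -/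
def gaussianMoment (k : ℕ) : ℝ := ∫ x : ℝ, x ^ k * Real.exp (-x ^ 2)

/-- The radial integral `∫ r^k e^{-r²} dr` over the positive half-line. -/
def radialMoment (k : ℕ) : ℝ := ∫ r in Set.Ioi (0 : ℝ), r ^ k * Real.exp (-r ^ 2)

theorem gaussianMoment_odd {k : ℕ} (hk : Odd k) : gaussianMoment k = 0 := by
  have h := integral_neg_eq_self (fun x : ℝ => x ^ k * Real.exp (-x ^ 2)) volume
  simp only [hk.neg_pow, neg_sq, neg_mul, integral_neg] at h
  unfold gaussianMoment
  linarith

theorem gaussianMoment_even {k : ℕ} (hk : Even k) : gaussianMoment k = 2 * radialMoment k := by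
  have h := integral_comp_abs (f := fun x : ℝ => x ^ k * Real.exp (-x ^ 2))
  simp only [hk.pow_abs, sq_abs] at h
  exact h

theorem radialMoment_eq (k : ℕ) : radialMoment k = 1 / 2 * Real.Gamma ((k + 1) / 2) := by
  have h := integral_rpow_mul_exp_neg_rpow (p := 2) (q := k) two_pos
    (by linarith [(Nat.cast_nonneg k : (0 : ℝ) ≤ k)])
  rw [← h, radialMoment]
  refine setIntegral_congr_fun measurableSet_Ioi fun x _ => ?_
  simp

theorem radialMoment_pos (k : ℕ) : 0 < radialMoment k := by
  rw [radialMoment_eq]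
  have := Real.Gamma_pos_of_pos (s := ((k : ℝ) + 1) / 2) (by positivity)
  positivity

theorem radialMoment_add_two (k : ℕ) : radialMoment (k + 2) = (k + 1) / 2 * radialMoment k := by
  rw [radialMoment_eq, radialMoment_eq]
  have h : (((k + 2 : ℕ) : ℝ) + 1) / 2 = ((k : ℝ) + 1) / 2 + 1 := by push_cast; ring
  rw [h, Real.Gamma_add_one (by positivity)]
  ring

theorem gaussianMoment_zero_sq : gaussianMoment 0 * gaussianMoment 0 = Real.pi := by
  have h := integral_gaussian 1
  have : gaussianMoment 0 = √Real.pi := by simpa [gaussianMoment] using h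
  rw [this, Real.mul_self_sqrt Real.pi_pos.le]

/-- Integration in polar coordinates of a homogeneous function against a Gaussian. -/
theorem integral_homogeneous_mul_gaussian (F : EuclideanSpace ℝ (Fin 3) → ℝ) (k : ℕ)
    (hF : ∀ r > 0, ∀ x, F (r • x) = r ^ k * F x) :
    ∫ x, F x * Real.exp (-‖x‖ ^ 2) =
      (∫ η : Sphere, F η ∂sphereMeasure) * radialMoment (k + 2) := by
  have hdim : Module.finrank ℝ (EuclideanSpace ℝ (Fin 3)) = 3 := by simp
  calc ∫ x, F x * Real.exp (-‖x‖ ^ 2)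
      = ∫ x : ({0}ᶜ : Set (EuclideanSpace ℝ (Fin 3))), F x.1 * Real.exp (-‖x.1‖ ^ 2)
          ∂(volume.comap Subtype.val) := by
        rw [integral_subtype_comap (measurableSet_singleton _).compl
          fun x : EuclideanSpace ℝ (Fin 3) => F x * Real.exp (-‖x‖ ^ 2),
          restrict_compl_singleton]
    _ = ∫ y : Sphere × Set.Ioi (0 : ℝ), F y.1 * (y.2.1 ^ k * Real.exp (-y.2.1 ^ 2))
          ∂(sphereMeasure.prod (.volumeIoiPow 2)) := by
        have h := (volume : Measure (EuclideanSpace ℝ (Fin 3))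
          ).measurePreserving_homeomorphUnitSphereProd.integral_comp
          (Homeomorph.measurableEmbedding _)
          (fun y => F y.1 * (y.2.1 ^ k * Real.exp (-y.2.1 ^ 2)))
        rw [hdim] at h
        rw [← h]
        refine integral_congr_ae (.of_forall fun x => ?_)
        have hx : 0 < ‖x.1‖ := norm_pos_iff.2 x.2
        have hx' : F x = ‖x.1‖ ^ k * F (‖x.1‖⁻¹ • x.1) := by
          rw [← hF _ hx, smul_smul, mul_inv_cancel₀ hx.ne', one_smul]
        simp only [homeomorphUnitSphereProd_apply_snd_coe,
          homeomorphUnitSphereProd_apply_fst_coe, hx']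
        ring
    _ = (∫ η : Sphere, F η ∂sphereMeasure) *
          ∫ r : Set.Ioi (0 : ℝ), r.1 ^ k * Real.exp (-r.1 ^ 2) ∂(.volumeIoiPow 2) :=
        integral_prod_mul (fun η : Sphere => F η)
          (fun r : Set.Ioi (0 : ℝ) => r.1 ^ k * Real.exp (-r.1 ^ 2))
    _ = _ := by
        congr 1
        simp only [Measure.volumeIoiPow, ENNReal.ofReal]
        rw [integral_withDensity_eq_integral_smul,
          integral_subtype_comap measurableSet_Ioi
            fun a : ℝ => Real.toNNReal (a ^ 2) • (a ^ k * Real.exp (-a ^ 2)), radialMoment]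
        · refine setIntegral_congr_fun measurableSet_Ioi fun x hx => ?_
          rw [NNReal.smul_def, Real.coe_toNNReal _ (sq_nonneg x), smul_eq_mul]
          ring
        · exact (measurable_subtype_coe.pow_const _).real_toNNReal

/-- The integral over the sphere of `⟨e₀, η⟩^a ⟨e₁, η⟩^i` for orthonormal vectors `e₀`, `e₁`, as a
quotient of Gaussian moments; see `integral_inner_pow_mul_inner_pow`. -/
def sphereMoment (a i : ℕ) : ℝ :=
  gaussianMoment a * gaussianMoment i * gaussianMoment 0 / radialMoment (a + i + 2)

theorem integral_inner_pow_mul_inner_pow (b : OrthonormalBasis (Fin 3) ℝ (EuclideanSpace ℝ (Fin 3)))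
    (a i : ℕ) :
    ∫ η : Sphere, ⟪b 0,η⟫ ^ a *
      ⟪b 1,η⟫ ^ i ∂sphereMeasure = sphereMoment a i := by
  -- the Gaussian integral over the whole space factors in the coordinates of the basis `b`
  have h1 := integral_homogeneous_mul_gaussian
    (fun x => ⟪b 0,x⟫ ^ a * ⟪b 1,x⟫ ^ i) (a + i)
    (fun r _ x => by simp only [inner_smul_right]; ring)
  rw [sphereMoment, eq_div_iff (radialMoment_pos _).ne', ← h1]
  let f : Fin 3 → ℝ → ℝ := ![fun x => x ^ a * Real.exp (-x ^ 2),
    fun x => x ^ i * Real.exp (-x ^ 2), fun x => x ^ 0 * Real.exp (-x ^ 2)]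
  have h2 := integral_fintype_prod_eq_prod (𝕜 := ℝ) (μ := fun _ : Fin 3 => (volume : Measure ℝ)) f
  have h3 := ((EuclideanSpace.volume_preserving_symm_measurableEquiv_toLp (Fin 3)).comp
    b.repr.measurePreserving).integral_comp
    ((MeasurableEquiv.measurableEmbedding _).comp b.repr.toHomeomorph.measurableEmbedding)
    (fun y : Fin 3 → ℝ => ∏ i, f i (y i))
  rw [volume_pi, h2] at h3
  simp only [Fin.prod_univ_three] at h3
  refine Eq.trans ?_ h3
  refine integral_congr_ae (.of_forall fun x => ?_)
  have hn : ‖x‖ ^ 2 = ⟪b 0,x⟫ ^ 2 + ⟪b 1,x⟫ ^ 2 + ⟪b 2,x⟫ ^ 2 := by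
    rw [← b.sum_sq_norm_inner_right x, Fin.sum_univ_three]
    simp
  have he : Real.exp (-‖x‖ ^ 2) = Real.exp (-⟪b 0,x⟫ ^ 2) *
      Real.exp (-⟪b 1,x⟫ ^ 2) * Real.exp (-⟪b 2,x⟫ ^ 2) := by
    rw [← Real.exp_add, ← Real.exp_add, hn]; congr 1; ring
  simp only [he]
  simp [f, b.repr_apply_apply]
  ring

theorem exists_orthonormalBasis_of_unit_orthogonal {u v : EuclideanSpace ℝ (Fin 3)}
    (hu : ‖u‖ = 1) (hv : ‖v‖ = 1) (huv : inner ℝ u v = 0) :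
    ∃ b : OrthonormalBasis (Fin 3) ℝ (EuclideanSpace ℝ (Fin 3)), b 0 = u ∧ b 1 = v := by
  have hvu : inner ℝ v u = 0 := by rw [real_inner_comm]; exact huv
  obtain ⟨b, hb⟩ := Orthonormal.exists_orthonormalBasis_extension_of_card_eq (𝕜 := ℝ)
    (E := EuclideanSpace ℝ (Fin 3)) (ι := Fin 3) (by simp) (v := ![u, v, 0]) (s := {0, 1}) (by
      constructor
      · rintro ⟨i, rfl | rfl⟩ <;> simp [hu, hv]
      · rintro ⟨i, rfl | rfl⟩ ⟨j, rfl | rfl⟩ hij <;> simp_all)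
  exact ⟨b, by simpa using hb 0 (by simp), by simpa using hb 1 (by simp)⟩

/-- Every `ξ` on the sphere is `t ζ + s e` with `e` a unit vector orthogonal to `ζ`. -/
theorem exists_eq_smul_add_smul (ξ ζ : Sphere) :
    ∃ b : OrthonormalBasis (Fin 3) ℝ (EuclideanSpace ℝ (Fin 3)), ∃ s : ℝ, b 0 = ζ ∧
      (ξ : EuclideanSpace ℝ (Fin 3)) =
        (⟪ξ,ζ⟫ : ℝ) • b 0 + s • b 1 ∧
      s ^ 2 = 1 - (⟪ξ,ζ⟫ : ℝ) ^ 2 := by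
  obtain ⟨ξ, hξ⟩ := ξ
  obtain ⟨ζ, hζ⟩ := ζ
  simp only [mem_sphere_zero_iff_norm] at hξ hζ
  simp only
  set t : ℝ := inner ℝ ξ ζ with ht
  set y := ξ - t • ζ with hy
  have hyζ : inner ℝ ζ y = 0 := by
    rw [hy, inner_sub_right, inner_smul_right, real_inner_self_eq_norm_sq, hζ,
      real_inner_comm]
    simp [ht]
  have hyn : ‖y‖ ^ 2 = 1 - t ^ 2 := by
    rw [hy, norm_sub_sq_real, inner_smul_right, norm_smul, hξ, hζ, ← ht]
    simp
    ring
  -- for `ξ = ± ζ` any unit vector orthogonal to `ζ` will do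
  by_cases h0 : y = 0
  · obtain ⟨b, hb⟩ := Orthonormal.exists_orthonormalBasis_extension_of_card_eq (𝕜 := ℝ)
      (E := EuclideanSpace ℝ (Fin 3)) (ι := Fin 3) (by simp) (v := fun _ => ζ) (s := {0}) (by
        constructor
        · rintro ⟨i, rfl⟩; simp [hζ]
        · rintro ⟨i, rfl⟩ ⟨j, rfl⟩ hij; simp_all)
    have hb0 : b 0 = ζ := hb 0 (by simp)
    refine ⟨b, 0, hb0, ?_, ?_⟩
    · rw [hb0, zero_smul, add_zero]; exact sub_eq_zero.1 h0
    · rw [← hyn, h0]; simp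
  · have hy0 : ‖y‖ ≠ 0 := norm_ne_zero_iff.2 h0
    obtain ⟨b, hb0, hb1⟩ := exists_orthonormalBasis_of_unit_orthogonal hζ
      (v := ‖y‖⁻¹ • y) (by rw [norm_smul, norm_inv, norm_norm, inv_mul_cancel₀ hy0])
      (by rw [inner_smul_right, hyζ, mul_zero])
    refine ⟨b, ‖y‖, hb0, ?_, hyn⟩
    rw [hb0, hb1, smul_smul, mul_inv_cancel₀ hy0, one_smul, hy]
    abel

theorem integrable_of_continuous {E : Type*} [NormedAddCommGroup E] {f : Sphere → E}
    (hf : Continuous f) : Integrable f sphereMeasure :=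
  hf.integrable_of_hasCompactSupport (.of_compactSpace _)

theorem integral_inner_pow (ζ : Sphere) (n : ℕ) :
    ∫ η : Sphere, ⟪ζ,η⟫ ^ n
      ∂sphereMeasure = sphereMoment n 0 := by
  obtain ⟨b, s, hb, -⟩ := exists_eq_smul_add_smul ζ ζ
  simpa [hb] using integral_inner_pow_mul_inner_pow b n 0

/-- The linear functional `p ↦ ∫ p(ζ · η) dη`, which does not depend on `ζ`. It is defined by its
values on monomials; see `integral_eval_inner`. -/
def zonalIntegral : ℝ[X] →ₗ[ℝ] ℝ := Polynomial.lsum fun n => sphereMoment n 0 • LinearMap.id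

theorem zonalIntegral_monomial (n : ℕ) (a : ℝ) :
    zonalIntegral (monomial n a) = sphereMoment n 0 * a := by
  simp [zonalIntegral]

theorem integral_eval_inner (ζ : Sphere) (p : ℝ[X]) :
    ∫ η : Sphere, p.eval (⟪ζ,η⟫)
      ∂sphereMeasure = zonalIntegral p := by
  induction p using Polynomial.induction_on' with
  | add p q hp hq =>
    simp only [eval_add, map_add]
    rw [integral_add (integrable_of_continuous (by fun_prop))
      (integrable_of_continuous (by fun_prop)), hp, hq]
  | monomial n a =>
    simp only [eval_monomial]
    rw [integral_const_mul, integral_inner_pow, zonalIntegral_monomial, mul_comm]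

/-- The theorem of Archimedes: `∫ p(ζ · η) dη = 2π ∫ p(t) dt` over `-1 ≤ t ≤ 1`, in a form
without the integral on the right. -/
theorem zonalIntegral_derivative (p : ℝ[X]) :
    zonalIntegral (derivative p) = 2 * Real.pi * (p.eval 1 - p.eval (-1)) := by
  induction p using Polynomial.induction_on' with
  | add p q hp hq => simp only [map_add, eval_add, hp, hq]; ring
  | monomial n a =>
    rw [derivative_monomial, zonalIntegral_monomial]
    cases n with
    | zero => simp
    | succ k =>
      have hr := (radialMoment_pos k).ne'
      simp only [Nat.add_sub_cancel, eval_monomial, one_pow, sphereMoment, add_zero, mul_assoc,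
        gaussianMoment_zero_sq, radialMoment_add_two]
      rcases Nat.even_or_odd k with hk | hk
      · rw [gaussianMoment_even hk, hk.add_one.neg_one_pow]
        push_cast
        field_simp
        ring
      · rw [gaussianMoment_odd hk, hk.add_one.neg_one_pow]
        simp

theorem eq_zero_of_zonalIntegral_mul_self {p : ℝ[X]} (hp : zonalIntegral (p * p) = 0)
    (ζ η : Sphere) :
    p.eval (⟪ζ,η⟫) = 0 := by
  rw [← integral_eval_inner ζ] at hp
  simp only [eval_mul] at hp
  have hc : Continuous fun η : Sphere =>
      p.eval (⟪ζ,η⟫) := by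
    fun_prop
  rw [integral_eq_zero_iff_of_nonneg (fun _ => mul_self_nonneg _)
    (integrable_of_continuous (hc.mul hc))] at hp
  have := (hc.mul hc).ae_eq_iff_eq sphereMeasure continuous_const |>.1 hp
  exact mul_self_eq_zero.1 (congrFun this η)

/-- The convolution of the zonal functions `t^n` and `t^m` is a zonal polynomial of degree at
most `n`. With `ξ = t ζ + s e` and `e` orthogonal to `ζ`, the binomial formula expands `(ξ · η)^n`;
only even powers of `s` have nonzero integrals, and `s² = 1 - t²`. -/
theorem exists_zonal_convolution_pow (n m : ℕ) : ∃ h ∈ degreeLT ℝ (n + 1), ∀ ξ ζ : Sphere,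
    ∫ η : Sphere, ⟪ξ,η⟫ ^ n *
      ⟪ζ,η⟫ ^ m ∂sphereMeasure =
    h.eval (⟪ξ,ζ⟫) := by
  refine ⟨∑ i ∈ Finset.range (n + 1), C (sphereMoment (i + m) (n - i) * n.choose i) *
    (X ^ i * (1 - X ^ 2) ^ ((n - i) / 2)), ?_, fun ξ ζ => ?_⟩
  · refine Submodule.sum_mem _ fun i hi => ?_
    rw [Finset.mem_range] at hi
    rw [mem_degreeLT]
    refine lt_of_le_of_lt ?_ (WithBot.coe_lt_coe.2 n.lt_succ_self)
    rw [degree_le_iff_coeff_zero]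
    intro k hk
    refine coeff_eq_zero_of_natDegree_lt (lt_of_le_of_lt ?_ (WithBot.coe_lt_coe.1 hk))
    have h2 : ((1 - X ^ 2 : ℝ[X]) ^ ((n - i) / 2)).natDegree ≤ (n - i) / 2 * 2 := by
      refine natDegree_pow_le.trans (Nat.mul_le_mul_left _ ?_)
      compute_degree
    refine (natDegree_C_mul_le _ _).trans (natDegree_mul_le.trans ?_)
    rw [natDegree_X_pow]
    omega
  · obtain ⟨b, s, hb, hξ, hs⟩ := exists_eq_smul_add_smul ξ ζ
    generalize ⟪ξ,ζ⟫ = t at *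
    rw [← hb, hξ]
    simp only [inner_add_left, real_inner_smul_left, add_pow, Finset.sum_mul]
    rw [integral_finsetSum _ fun i _ => integrable_of_continuous (by fun_prop), eval_finsetSum]
    refine Finset.sum_congr rfl fun i hi => ?_
    have h1 : ∀ η : Sphere,
        (t * ⟪b 0,η⟫) ^ i *
          (s * ⟪b 1,η⟫) ^ (n - i) * (n.choose i : ℝ) *
          ⟪b 0,η⟫ ^ m =
        (t ^ i * s ^ (n - i) * n.choose i) * (⟪b 0,η⟫ ^ (i + m) *
          ⟪b 1,η⟫ ^ (n - i)) := fun η => by ring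
    simp only [h1]
    rw [integral_const_mul, integral_inner_pow_mul_inner_pow]
    simp only [eval_mul, eval_C, eval_pow, eval_X, eval_sub, eval_one]
    rcases Nat.even_or_odd (n - i) with hk | hk
    · rw [← hs, ← pow_mul, Nat.mul_div_cancel' hk.two_dvd]
      ring
    · simp [sphereMoment, gaussianMoment_odd hk]

/-- The convolution of two zonal polynomials is a zonal polynomial whose degree is at most the
degree of the first factor. -/
theorem exists_zonal_convolution {N : ℕ} {p : ℝ[X]} (hp : p ∈ degreeLT ℝ N) (q : ℝ[X]) :
    ∃ h ∈ degreeLT ℝ N, ∀ ξ ζ : Sphere,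
    ∫ η : Sphere, p.eval (⟪ξ,η⟫) *
      q.eval (⟪ζ,η⟫)
      ∂sphereMeasure =
    h.eval (⟪ξ,ζ⟫) := by
  induction q using Polynomial.induction_on' with
  | add q₁ q₂ h₁ h₂ =>
    obtain ⟨f₁, hf₁, h₁⟩ := h₁
    obtain ⟨f₂, hf₂, h₂⟩ := h₂
    refine ⟨f₁ + f₂, Submodule.add_mem _ hf₁ hf₂, fun ξ ζ => ?_⟩
    simp only [eval_add, mul_add]
    rw [integral_add (integrable_of_continuous (by fun_prop))
      (integrable_of_continuous (by fun_prop)), h₁, h₂]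
  | monomial m a =>
    rw [degreeLT_eq_span_X_pow] at hp
    induction hp using Submodule.span_induction with
    | mem x hx =>
      simp only [Finset.coe_image, Set.mem_image, Finset.mem_coe, Finset.mem_range] at hx
      obtain ⟨n, hn, rfl⟩ := hx
      obtain ⟨h, hh, H⟩ := exists_zonal_convolution_pow n m
      refine ⟨a • h, Submodule.smul_mem _ _ (degreeLT_mono (by omega) hh), fun ξ ζ => ?_⟩
      simp only [eval_pow, eval_X, eval_monomial, eval_smul, ← H, mul_left_comm _ a]
      rw [integral_const_mul, smul_eq_mul]
    | zero => exact ⟨0, Submodule.zero_mem _, fun ξ ζ => by simp⟩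
    | add p₁ p₂ _ _ h₁ h₂ =>
      obtain ⟨f₁, hf₁, h₁⟩ := h₁
      obtain ⟨f₂, hf₂, h₂⟩ := h₂
      refine ⟨f₁ + f₂, Submodule.add_mem _ hf₁ hf₂, fun ξ ζ => ?_⟩
      simp only [eval_add, add_mul]
      rw [integral_add (integrable_of_continuous (by fun_prop))
        (integrable_of_continuous (by fun_prop)), h₁, h₂]
    | smul c p _ h =>
      obtain ⟨f, hf, h⟩ := h
      refine ⟨c • f, Submodule.smul_mem _ _ hf, fun ξ ζ => ?_⟩
      simp only [eval_smul, smul_eq_mul, mul_assoc]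
      rw [integral_const_mul, h]

theorem inner_self_sphere (ζ : Sphere) :
    ⟪ζ,ζ⟫ = 1 := by
  rw [real_inner_self_eq_norm_sq, mem_sphere_zero_iff_norm.1 ζ.2, one_pow]

/-- The convolution of two Legendre polynomials of degrees `m ≤ n` is a multiple of the second
one: it has degree at most `m ≤ n` and is orthogonal to all polynomials of degree less than `n`. -/
theorem integral_legendreP_mul_legendreP_of_le {m n : ℕ} (hmn : m ≤ n) (ξ ζ : Sphere) :
    ∫ η : Sphere,
      (legendreP m).eval (⟪ξ,η⟫) *
      (legendreP n).eval (⟪ζ,η⟫)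
      ∂sphereMeasure =
    zonalIntegral (legendreP m * legendreP n) *
      (legendreP n).eval (⟪ξ,ζ⟫) := by
  obtain ⟨h, hh, H⟩ := exists_zonal_convolution (legendreP_mem_degreeLT m) (legendreP n)
  -- associativity of the convolution moves `r` to the other factor without raising its degree
  have horth : ∀ r ∈ degreeLT ℝ n, zonalIntegral (h * r) = 0 := by
    intro r hr
    obtain ⟨g, hg, G⟩ := exists_zonal_convolution hr (legendreP m)
    rw [← integral_eval_inner ζ]
    have h1 : ∀ τ : Sphere, (h * r).eval (⟪ζ,τ⟫) =
        ∫ η : Sphere, (legendreP n).eval (⟪ζ,η⟫) *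
          (r.eval (⟪ζ,τ⟫) *
          (legendreP m).eval (⟪η,τ⟫)) ∂sphereMeasure := by
      intro τ
      rw [eval_mul, real_inner_comm, ← H, ← integral_mul_const]
      refine integral_congr_ae (.of_forall fun η => ?_)
      simp only [real_inner_comm (ζ : EuclideanSpace ℝ (Fin 3)) (τ : EuclideanSpace ℝ (Fin 3)),
        real_inner_comm (η : EuclideanSpace ℝ (Fin 3)) (τ : EuclideanSpace ℝ (Fin 3))]
      ring
    simp only [h1]
    rw [integral_integral_swap]
    · simp only [integral_const_mul, G]
      have := integral_eval_inner ζ (legendreP n * g)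
      simp only [eval_mul] at this
      rw [this, legendreP_orthogonal zonalIntegral_derivative n hg]
    · refine Continuous.integrable_of_hasCompactSupport ?_ (.of_compactSpace _)
      simp only [Function.uncurry_def]
      fun_prop
  have h1 : h.eval 1 = zonalIntegral (legendreP m * legendreP n) := by
    rw [← inner_self_sphere ζ, ← H, ← integral_eval_inner ζ]
    simp only [eval_mul]
  set c := h.coeff n / (legendreP n).coeff n with hc
  -- `h - c P_n` has degree less than `n`, so it is orthogonal to both terms of itself
  have hlow : h - C c * legendreP n ∈ degreeLT ℝ n := by
    rw [mem_degreeLT, degree_lt_iff_coeff_zero]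
    intro k hk
    rw [coeff_sub, coeff_C_mul]
    rcases hk.eq_or_lt with rfl | hk
    · rw [hc, div_mul_cancel₀ _ (coeff_legendreP_ne_zero _), sub_self]
    · rw [(degree_lt_iff_coeff_zero _ _).1 (mem_degreeLT.1 hh) k (by omega),
        coeff_eq_zero_of_natDegree_lt (by rw [natDegree_legendreP]; exact hk)]
      simp
  have hz : zonalIntegral ((h - C c * legendreP n) * (h - C c * legendreP n)) = 0 := by
    rw [sub_mul, map_sub, horth _ hlow, mul_assoc, ← smul_eq_C_mul, map_smul,
      legendreP_orthogonal zonalIntegral_derivative n hlow]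
    simp
  have hz' : ∀ ξ ζ : Sphere,
      h.eval (⟪ξ,ζ⟫) =
      c * (legendreP n).eval (⟪ξ,ζ⟫) := by
    intro ξ ζ
    have := eq_zero_of_zonalIntegral_mul_self hz ξ ζ
    rw [eval_sub, eval_mul, eval_C] at this
    linarith
  have hcv : c = zonalIntegral (legendreP m * legendreP n) := by
    have := hz' ζ ζ
    rw [inner_self_sphere, eval_one_legendreP, mul_one, h1] at this
    exact this.symm
  rw [H, hz', hcv]

theorem zonalIntegral_legendreP_mul_legendreP (m n : ℕ) :
    zonalIntegral (legendreP m * legendreP n) =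
      if m = n then 4 * Real.pi / (2 * n + 1) else 0 := by
  split_ifs with h
  · subst h
    have := legendreP_mul_self zonalIntegral_derivative m
    rw [eq_div_iff (by positivity)]
    linarith
  · rcases lt_or_gt_of_ne h with h | h
    · rw [mul_comm]
      exact legendreP_orthogonal zonalIntegral_derivative n
        (degreeLT_mono (by omega) (legendreP_mem_degreeLT m))
    · exact legendreP_orthogonal zonalIntegral_derivative m
        (degreeLT_mono (by omega) (legendreP_mem_degreeLT n))

/-- The reproducing property of the kernels `L_ℓ`. -/
theorem integral_legendreL_mul_legendreL (m n : ℕ) (ξ ζ : Sphere) :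
    ∫ η : Sphere,
      legendreL m (⟪η,ξ⟫) *
      legendreL n (⟪η,ζ⟫)
      ∂sphereMeasure =
    if m = n then legendreL n (⟪ξ,ζ⟫)
    else 0 := by
  wlog hmn : m ≤ n generalizing m n ξ ζ
  · have := this n m ζ ξ (by omega)
    simp only [mul_comm (legendreL n _)] at this
    rw [this]
    by_cases h : m = n
    · subst h; simp [real_inner_comm]
    · simp [h, Ne.symm h]
  have h := integral_legendreP_mul_legendreP_of_le hmn ξ ζ
  have h1 : ∀ η : Sphere, legendreL m ⟪η,ξ⟫ * legendreL n ⟪η,ζ⟫ =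
      ((2 * (m : ℝ) + 1) / (4 * Real.pi) * ((2 * (n : ℝ) + 1) / (4 * Real.pi))) *
        ((legendreP m).eval ⟪ξ,η⟫ * (legendreP n).eval ⟪ζ,η⟫) := fun η => by
    rw [real_inner_comm ξ.1 η.1, real_inner_comm ζ.1 η.1, legendreL, legendreL]
    ring
  simp only [h1]
  rw [integral_const_mul, h, zonalIntegral_legendreP_mul_legendreP]
  split_ifs with hmn
  · subst hmn
    rw [legendreL]
    have : (2 * (m : ℝ) + 1) ≠ 0 := by positivity
    field_simp
  · simp

/-! ### Polynomials and harmonic spaces -/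

/-- The sum of the harmonic spaces of degree at most `N`. -/
def harmonicSum (N : ℕ) : Submodule ℂ (Sphere → ℂ) :=
  ⨆ ℓ ∈ Finset.range (N + 1), harmonicSpace ℓ

theorem sphericalHarmonic_mem_harmonicSum {N ℓ : ℕ} (hℓ : ℓ ≤ N) {m : ℤ} (h₁ : -(ℓ : ℤ) ≤ m)
    (h₂ : m ≤ ℓ) : sphericalHarmonic ℓ m ∈ harmonicSum N :=
  (le_iSup₂_of_le (f := fun ℓ (_ : ℓ ∈ Finset.range (N + 1)) => harmonicSpace ℓ) ℓ
    (Finset.mem_range.2 (by omega)) le_rfl)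
    (Submodule.subset_span (Set.mem_image_of_mem _ ⟨h₁, h₂⟩))

/-- The function `ξ ↦ ξ₀ + i ξ₁`. -/
def azimuthal (ξ : Sphere) : ℂ := (ξ.1 0 : ℂ) + (ξ.1 1 : ℂ) * Complex.I

/-- Multiplication of a function `u` on the sphere by polynomials in the height `ξ₂`, as a linear map
of the polynomial. -/
def heightMul (u : Sphere → ℂ) : ℝ[X] →ₗ[ℝ] (Sphere → ℂ) where
  toFun p ξ := ((p.eval (ξ.1 2) : ℝ) : ℂ) * u ξ
  map_add' p q := by ext ξ; simp [add_mul]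
  map_smul' c p := by ext ξ; simp [mul_assoc]

/-- The derivatives `(d/dt)^m P_ℓ`, `m ≤ ℓ ≤ N`, have all degrees up to `N - m`, so they span the
polynomials of degree at most `N - m`. -/
theorem heightMul_mem {W : Submodule ℂ (Sphere → ℂ)} {u : Sphere → ℂ} {m N : ℕ}
    (h : ∀ ℓ, m ≤ ℓ → ℓ ≤ N → heightMul u (derivative^[m] (legendreP ℓ)) ∈ W)
    (hm : m ≤ N) {p : ℝ[X]} (hp : p ∈ degreeLT ℝ (N - m + 1)) : heightMul u p ∈ W := by
  refine mem_of_forall_natDegree_eq (V := (W.restrictScalars ℝ).comap (heightMul u))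
    (fun k hk => ⟨derivative^[m] (legendreP (k + m)), h _ (by omega) (by omega), ?_⟩) p hp
  have hc : (derivative^[m] (legendreP (k + m))).coeff k ≠ 0 := by
    rw [coeff_iterate_derivative]
    have := coeff_legendreP_ne_zero (k + m)
    simp [this]
  refine ⟨natDegree_eq_of_le_of_coeff_ne_zero ?_ hc, hc⟩
  refine (natDegree_iterate_derivative _ _).trans ?_
  rw [natDegree_legendreP]
  omega

/-- The harmonics of order `m ≥ 0` are `(ξ₀ + i ξ₁)^m` times polynomials in `ξ₂`. -/
theorem heightMul_azimuthal_pow_mem {m N : ℕ} (hm : m ≤ N) {p : ℝ[X]}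
    (hp : p ∈ degreeLT ℝ (N - m + 1)) : heightMul (azimuthal ^ m) p ∈ harmonicSum N := by
  refine heightMul_mem (fun ℓ h₁ h₂ => ?_) hm hp
  set a : ℝ := √((2 * (ℓ : ℝ) + 1) / (4 * Real.pi) *
      (((ℓ - m).factorial : ℝ) / ((ℓ + m).factorial : ℝ))) * (-1) ^ m with ha
  have ha0 : (a : ℂ) ≠ 0 := by
    have : 0 < Real.pi := Real.pi_pos
    rw [Complex.ofReal_ne_zero]
    refine mul_ne_zero (Real.sqrt_pos.2 (by positivity)).ne' (by simp)
  have hY := sphericalHarmonic_mem_harmonicSum (m := m) h₂ (by omega) (by omega)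
  convert (harmonicSum N).smul_mem (a : ℂ)⁻¹ hY using 1
  rw [eq_inv_smul_iff₀ ha0]
  ext ξ
  simp only [heightMul, sphericalHarmonic, sphericalHarmonicNonneg, azimuthal, ha,
    Pi.smul_apply, Pi.pow_apply, LinearMap.coe_mk, AddHom.coe_mk, smul_eq_mul, Int.natAbs_natCast,
    Int.natCast_nonneg, if_true]
  push_cast
  ring

/-- The harmonics of order `-m ≤ 0` are `(ξ₀ - i ξ₁)^m` times polynomials in `ξ₂`. -/
theorem heightMul_conj_azimuthal_pow_mem {m N : ℕ} (hm : m ≤ N) {p : ℝ[X]}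
    (hp : p ∈ degreeLT ℝ (N - m + 1)) : heightMul (star azimuthal ^ m) p ∈ harmonicSum N := by
  rcases Nat.eq_zero_or_pos m with rfl | hm0
  · simpa using heightMul_azimuthal_pow_mem hm hp
  refine heightMul_mem (fun ℓ h₁ h₂ => ?_) hm hp
  set a : ℝ := √((2 * (ℓ : ℝ) + 1) / (4 * Real.pi) *
      (((ℓ - m).factorial : ℝ) / ((ℓ + m).factorial : ℝ))) with ha
  have ha0 : (a : ℂ) ≠ 0 := by
    have : 0 < Real.pi := Real.pi_pos
    rw [Complex.ofReal_ne_zero]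
    exact (Real.sqrt_pos.2 (by positivity)).ne'
  have hY := sphericalHarmonic_mem_harmonicSum (m := -(m : ℤ)) h₂ (by omega) (by omega)
  convert (harmonicSum N).smul_mem (a : ℂ)⁻¹ hY using 1
  rw [eq_inv_smul_iff₀ ha0]
  ext ξ
  have hneg : ¬ (0 : ℤ) ≤ -(m : ℤ) := by omega
  have hs : ((-1 : ℂ) ^ m) * (-1) ^ m = 1 := by rw [← mul_pow]; simp
  simp only [heightMul, sphericalHarmonic, sphericalHarmonicNonneg, azimuthal, ← ha,
    Pi.smul_apply, Pi.pow_apply, Pi.star_apply, LinearMap.coe_mk, AddHom.coe_mk, smul_eq_mul,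
    Int.natAbs_neg, Int.natAbs_natCast, hneg, if_false, map_mul, map_pow, map_add,
    Complex.conj_ofReal, Complex.star_def]
  push_cast
  generalize (derivative^[m] (legendreP ℓ)).eval (ξ.1 2) = e
  linear_combination (-(a * e * ((ξ.1 0 : ℂ) + (ξ.1 1 : ℂ) *
    (starRingEnd ℂ) Complex.I) ^ m)) * hs

/-- The restrictions to the sphere of the complex polynomials of degree at most `1`. -/
def affineSpace : Submodule ℂ (Sphere → ℂ) :=
  Submodule.span ℂ {1, azimuthal, star azimuthal, fun ξ => (ξ.1 2 : ℂ)}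

theorem azimuthal_mul_star (ξ : Sphere) :
    azimuthal ξ * star (azimuthal ξ) = 1 - (ξ.1 2 : ℂ) ^ 2 := by
  have h : ξ.1 0 ^ 2 + ξ.1 1 ^ 2 + ξ.1 2 ^ 2 = 1 := by
    have := EuclideanSpace.real_norm_sq_eq ξ.1
    rw [mem_sphere_zero_iff_norm.1 ξ.2, Fin.sum_univ_three] at this
    linarith
  have h' : (ξ.1 0 : ℂ) ^ 2 + (ξ.1 1 : ℂ) ^ 2 + (ξ.1 2 : ℂ) ^ 2 = 1 := by
    simpa only [Complex.ofReal_add, Complex.ofReal_pow, Complex.ofReal_one] using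
      congrArg Complex.ofReal h
  simp only [azimuthal, Complex.star_def, map_add, map_mul, Complex.conj_ofReal, Complex.conj_I]
  linear_combination h' - (ξ.1 1 : ℂ) ^ 2 * Complex.I_sq

/-- The monomial `u^a ū^b z^c` with `u = ξ₀ + i ξ₁` and `z = ξ₂` is a polynomial in `z` times a
power of `u` or of `ū`, since `u ū = 1 - z²`. -/
theorem monomial_mem_harmonicSum {N a b c : ℕ} (h : a + b + c ≤ N) :
    azimuthal ^ a * star azimuthal ^ b * (fun ξ : Sphere => (ξ.1 2 : ℂ)) ^ c ∈ harmonicSum N := by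
  have hdeg : ∀ k e : ℕ, 2 * k + c < e →
      ((1 - X ^ 2) ^ k * X ^ c : ℝ[X]) ∈ degreeLT ℝ e := by
    intro k e he
    rw [mem_degreeLT, degree_lt_iff_coeff_zero]
    intro i hi
    refine coeff_eq_zero_of_natDegree_lt (natDegree_mul_le.trans_lt ?_)
    have h2 : ((1 - X ^ 2 : ℝ[X]) ^ k).natDegree ≤ k * 2 :=
      natDegree_pow_le.trans (Nat.mul_le_mul_left _ (by compute_degree))
    rw [natDegree_X_pow]
    omega
  rcases le_total b a with hab | hab
  · convert heightMul_azimuthal_pow_mem (m := a - b) (N := N) (by omega)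
      (hdeg b _ (by omega)) using 1
    ext ξ
    obtain ⟨d, rfl⟩ := Nat.exists_eq_add_of_le hab
    have := azimuthal_mul_star ξ
    simp only [heightMul, Pi.mul_apply, Pi.pow_apply, Pi.star_apply, LinearMap.coe_mk,
      AddHom.coe_mk, eval_mul, eval_pow, eval_sub, eval_one, eval_X, Nat.add_sub_cancel_left]
    push_cast
    rw [← this]
    ring
  · convert heightMul_conj_azimuthal_pow_mem (m := b - a) (N := N) (by omega)
      (hdeg a _ (by omega)) using 1
    ext ξ
    obtain ⟨d, rfl⟩ := Nat.exists_eq_add_of_le hab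
    have := azimuthal_mul_star ξ
    simp only [heightMul, Pi.mul_apply, Pi.pow_apply, Pi.star_apply, LinearMap.coe_mk,
      AddHom.coe_mk, eval_mul, eval_pow, eval_sub, eval_one, eval_X, Nat.add_sub_cancel_left]
    push_cast
    rw [← this]
    ring

/-- Polynomials of degree at most `N` restrict to sums of harmonics of degree at most `N`. -/
theorem affineSpace_pow_le (N : ℕ) : affineSpace ^ N ≤ harmonicSum N := by
  rw [affineSpace, Submodule.span_pow, Submodule.span_le]
  have key : ∀ f ∈ ({1, azimuthal, star azimuthal, fun ξ => (ξ.1 2 : ℂ)} : Set (Sphere → ℂ)) ^ N,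
      ∃ a b c : ℕ, a + b + c ≤ N ∧
        f = azimuthal ^ a * star azimuthal ^ b * (fun ξ : Sphere => (ξ.1 2 : ℂ)) ^ c := by
    induction N with
    | zero => intro f hf; exact ⟨0, 0, 0, le_rfl, by simpa using hf⟩
    | succ N ih =>
      intro f hf
      rw [pow_succ, Set.mem_mul] at hf
      obtain ⟨g, hg, x, hx, rfl⟩ := hf
      obtain ⟨a, b, c, h, rfl⟩ := ih g hg
      rcases hx with rfl | rfl | rfl | rfl
      · exact ⟨a, b, c, by omega, by ring⟩
      · exact ⟨a + 1, b, c, by omega, by ring⟩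
      · exact ⟨a, b + 1, c, by omega, by ring⟩
      · exact ⟨a, b, c + 1, by omega, by ring⟩
  intro f hf
  obtain ⟨a, b, c, h, rfl⟩ := key f hf
  exact monomial_mem_harmonicSum h

theorem inner_mem_affineSpace (ζ : Sphere) : (fun η : Sphere => (⟪η,ζ⟫ : ℂ)) ∈ affineSpace := by
  have h1 : azimuthal ∈ affineSpace := Submodule.subset_span (by simp)
  have h2 : star azimuthal ∈ affineSpace := Submodule.subset_span (by simp)
  have h3 : (fun ξ : Sphere => (ξ.1 2 : ℂ)) ∈ affineSpace := Submodule.subset_span (by simp)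
  convert add_mem (add_mem (affineSpace.smul_mem ((ζ.1 0 - ζ.1 1 * Complex.I) / 2 : ℂ) h1)
    (affineSpace.smul_mem ((ζ.1 0 + ζ.1 1 * Complex.I) / 2 : ℂ) h2))
    (affineSpace.smul_mem (ζ.1 2 : ℂ) h3) using 1
  ext η
  have : ⟪η,ζ⟫ = η.1 0 * ζ.1 0 + η.1 1 * ζ.1 1 + η.1 2 * ζ.1 2 := by
    simp [PiLp.inner_apply, Fin.sum_univ_three, mul_comm]
  rw [this]
  simp only [azimuthal, Pi.add_apply, Pi.smul_apply, Pi.star_apply, Complex.star_def, map_add,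
    map_mul, Complex.conj_ofReal, Complex.conj_I, smul_eq_mul]
  push_cast
  linear_combination (η.1 1 * ζ.1 1 : ℂ) * Complex.I_sq

theorem eval_inner_mem_affineSpace_pow (ζ : Sphere) {n : ℕ} {p : ℝ[X]}
    (hp : p ∈ degreeLT ℝ (n + 1)) :
    (fun η : Sphere => ((p.eval ⟪η,ζ⟫ : ℝ) : ℂ)) ∈ affineSpace ^ n := by
  have hone : (1 : Submodule ℂ (Sphere → ℂ)) ≤ affineSpace :=
    Submodule.one_le.2 (Submodule.subset_span (by simp))
  rw [degreeLT_eq_span_X_pow] at hp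
  induction hp using Submodule.span_induction with
  | mem x hx =>
    simp only [Finset.coe_image, Set.mem_image, Finset.mem_coe, Finset.mem_range] at hx
    obtain ⟨k, hk, rfl⟩ := hx
    refine pow_le_pow_right' hone (by omega : k ≤ n) ?_
    convert Submodule.pow_mem_pow _ (inner_mem_affineSpace ζ) k using 1
    ext η
    simp
  | zero =>
    convert (affineSpace ^ n).zero_mem using 1
    ext η
    simp
  | add p q _ _ h₁ h₂ =>
    convert add_mem h₁ h₂ using 1
    ext η
    simp
  | smul c p _ h =>
    convert (affineSpace ^ n).smul_mem (c : ℂ) h using 1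
    ext η
    simp

theorem legendreL_mul_legendreL_mem_harmonicSum {m n N : ℕ} (h : m + n ≤ N) (ξ ζ : Sphere) :
    (fun η : Sphere => ((legendreL m ⟪η,ξ⟫ * legendreL n ⟪η,ζ⟫ : ℝ) : ℂ)) ∈ harmonicSum N := by
  have hone : (1 : Submodule ℂ (Sphere → ℂ)) ≤ affineSpace :=
    Submodule.one_le.2 (Submodule.subset_span (by simp))
  have hL : ∀ (k : ℕ) (τ : Sphere),
      (fun η : Sphere => ((legendreL k ⟪η,τ⟫ : ℝ) : ℂ)) ∈ affineSpace ^ k := by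
    intro k τ
    convert eval_inner_mem_affineSpace_pow τ ((degreeLT ℝ (k + 1)).smul_mem
      ((2 * (k : ℝ) + 1) / (4 * Real.pi)) (legendreP_mem_degreeLT k)) using 1
    ext η
    simp [legendreL]
  refine affineSpace_pow_le N (pow_le_pow_right' hone h ?_)
  rw [pow_add]
  convert Submodule.mul_mem_mul (hL m ξ) (hL n ζ) using 1
  ext η
  simp

/-- An exact quadrature formula at degree `N ≥ m + n` inherits the reproducing property. -/
theorem IsExactQuadrature.sum_legendreL_mul_legendreL {K : Type*} [Fintype K] {ξ : K → Sphere}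
    {w : K → ℝ} {N : ℕ} (hq : IsExactQuadrature ξ w N) {m n : ℕ} (h : m + n ≤ N) (τ ζ : Sphere) :
    ∑ k, w k * (legendreL m ⟪ξ k,τ⟫ * legendreL n ⟪ξ k,ζ⟫) =
      if m = n then legendreL n ⟪τ,ζ⟫ else 0 := by
  have h1 := hq _ (legendreL_mul_legendreL_mem_harmonicSum h τ ζ)
  rw [integral_complex_ofReal, integral_legendreL_mul_legendreL] at h1
  exact_mod_cast h1.symm

/-! ### Density of the zonal kernels -/

/-- The zonal function `η ↦ p(η · ζ)` of a polynomial `p`, linear in `p`. -/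
def zonal (ζ : Sphere) : ℝ[X] →ₗ[ℝ] C(Sphere, ℂ) where
  toFun p := ⟨fun η => ((p.eval ⟪η,ζ⟫ : ℝ) : ℂ), by fun_prop⟩
  map_add' p q := by ext η; simp
  map_smul' c p := by ext η; simp

/-- The zonal kernel `η ↦ L_ℓ(η · ζ)`. -/
def zonalKernel (ℓ : ℕ) (ζ : Sphere) : C(Sphere, ℂ) where
  toFun η := ((legendreL ℓ ⟪η,ζ⟫ : ℝ) : ℂ)
  continuous_toFun := by
    unfold legendreL
    fun_prop

/-- The linear form `η ↦ η · v`. -/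
def linearForm (v : EuclideanSpace ℝ (Fin 3)) : C(Sphere, ℂ) where
  toFun η := ((⟪η,v⟫ : ℝ) : ℂ)
  continuous_toFun := by fun_prop

/-- The span of all zonal kernels. -/
def zonalSpan : Submodule ℂ C(Sphere, ℂ) :=
  Submodule.span ℂ (Set.range fun i : ℕ × Sphere => zonalKernel i.1 i.2)

theorem zonal_mem_zonalSpan (ζ : Sphere) (p : ℝ[X]) : zonal ζ p ∈ zonalSpan := by
  have hp : p ∈ degreeLT ℝ (p.natDegree + 1) := by
    rw [mem_degreeLT]
    exact degree_le_natDegree.trans_lt (by exact_mod_cast p.natDegree.lt_succ_self)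
  refine mem_of_forall_natDegree_eq (V := (zonalSpan.restrictScalars ℝ).comap (zonal ζ))
    (fun k _ => ⟨legendreP k, ?_, natDegree_legendreP k, coeff_legendreP_ne_zero k⟩) p hp
  have hc : (((2 * (k : ℝ) + 1) / (4 * Real.pi) : ℝ) : ℂ) ≠ 0 := by
    rw [Complex.ofReal_ne_zero]
    have := Real.pi_pos
    positivity
  have hk : zonalKernel k ζ ∈ zonalSpan := Submodule.subset_span ⟨(k, ζ), rfl⟩
  change zonal ζ (legendreP k) ∈ zonalSpan
  convert zonalSpan.smul_mem (((2 * (k : ℝ) + 1) / (4 * Real.pi) : ℝ) : ℂ)⁻¹ hk using 1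
  rw [eq_inv_smul_iff₀ hc]
  ext η
  simp [zonal, zonalKernel, legendreL]

theorem linearForm_pow_mem_zonalSpan (v : EuclideanSpace ℝ (Fin 3)) (n : ℕ) :
    linearForm v ^ n ∈ zonalSpan := by
  obtain ⟨ζ, hζ⟩ : ∃ ζ : Sphere, v = ‖v‖ • (ζ : EuclideanSpace ℝ (Fin 3)) := by
    by_cases hv : v = 0
    · exact ⟨⟨EuclideanSpace.single 0 1, by simp⟩, by simp [hv]⟩
    · refine ⟨⟨‖v‖⁻¹ • v, ?_⟩, ?_⟩
      · rw [mem_sphere_zero_iff_norm, norm_smul, norm_inv, norm_norm,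
          inv_mul_cancel₀ (norm_ne_zero_iff.2 hv)]
      · rw [smul_smul, mul_inv_cancel₀ (norm_ne_zero_iff.2 hv), one_smul]
  convert zonal_mem_zonalSpan ζ ((‖v‖ ^ n) • X ^ n) using 1
  ext η
  have : ⟪η,v⟫ = ‖v‖ * ⟪η,ζ⟫ := by
    conv_lhs => rw [hζ]
    rw [inner_smul_right]
  simp [zonal, linearForm, this, mul_pow]

theorem exp_linearForm_mem_closure (v : EuclideanSpace ℝ (Fin 3)) :
    NormedSpace.exp (linearForm v) ∈ zonalSpan.topologicalClosure := by
  have h := NormedSpace.exp_series_hasSum_exp' (𝕂 := ℂ) (linearForm v)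
  refine zonalSpan.isClosed_topologicalClosure.mem_of_tendsto h (.of_forall fun s => ?_)
  exact zonalSpan.le_topologicalClosure
    (Submodule.sum_mem _ fun n _ => zonalSpan.smul_mem _ (linearForm_pow_mem_zonalSpan v n))

theorem linearForm_add (v v' : EuclideanSpace ℝ (Fin 3)) :
    linearForm (v + v') = linearForm v + linearForm v' := by
  ext η
  simp [linearForm, inner_add_right]

theorem linearForm_zero : linearForm 0 = 0 := by
  ext η
  simp [linearForm]

theorem exp_linearForm_apply (v : EuclideanSpace ℝ (Fin 3)) (η : Sphere) :
    NormedSpace.exp (linearForm v) η = ((Real.exp ⟪η,v⟫ : ℝ) : ℂ) := by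
  have h := NormedSpace.map_exp (ContinuousMap.evalStarAlgHom ℂ ℂ η)
    (continuous_eval_const η) (linearForm v)
  simp only [ContinuousMap.evalStarAlgHom_apply] at h
  rw [h, ← Complex.exp_eq_exp_ℂ, Complex.ofReal_exp]
  rfl

/-- The exponentials `exp (η · v)` are closed under multiplication. -/
def expMonoid : Submonoid C(Sphere, ℂ) where
  carrier := Set.range fun v => NormedSpace.exp (linearForm v)
  one_mem' := ⟨0, by simp [linearForm_zero]⟩
  mul_mem' := by
    rintro _ _ ⟨v, rfl⟩ ⟨v', rfl⟩
    exact ⟨v + v', by simp only [linearForm_add]; rw [NormedSpace.exp_add]⟩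

/-- The self-adjoint algebra spanned by the exponentials `exp (η · v)`. -/
def expAlgebra : StarSubalgebra ℂ C(Sphere, ℂ) where
  __ := Algebra.adjoin ℂ (expMonoid : Set C(Sphere, ℂ))
  star_mem' {f} hf := by
    change star f ∈ Algebra.adjoin ℂ (expMonoid : Set C(Sphere, ℂ))
    induction hf using Algebra.adjoin_induction with
    | mem x hx =>
      obtain ⟨v, rfl⟩ := hx
      have : star (NormedSpace.exp (linearForm v)) = NormedSpace.exp (linearForm v) := by
        ext η
        rw [ContinuousMap.star_apply, exp_linearForm_apply, Complex.star_def, Complex.conj_ofReal]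
      simp only [this]
      exact Algebra.subset_adjoin ⟨v, rfl⟩
    | algebraMap r =>
      rw [← algebraMap_star_comm]
      exact Subalgebra.algebraMap_mem _ _
    | add x y _ _ hx hy => rw [star_add]; exact add_mem hx hy
    | mul x y _ _ hx hy => rw [star_mul]; exact mul_mem hy hx

/-- The zonal kernels span a dense subspace of the continuous functions: their closed span
contains the exponentials `exp (η · v)`, to which the Stone–Weierstrass theorem applies. -/
theorem zonalSpan_topologicalClosure : zonalSpan.topologicalClosure = ⊤ := by
  have hsep : expAlgebra.SeparatesPoints := by
    intro x y hxy
    refine ⟨_, ⟨NormedSpace.exp (linearForm (x.1 - y.1)),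
      Algebra.subset_adjoin ⟨_, rfl⟩, rfl⟩, fun h => hxy ?_⟩
    simp only [exp_linearForm_apply, Complex.ofReal_inj, Real.exp_eq_exp] at h
    have h' : ⟪x.1 - y.1, x.1 - y.1⟫ = 0 := by rw [inner_sub_left, h, sub_self]
    exact Subtype.ext (sub_eq_zero.1 (inner_self_eq_zero.1 h'))
  have htop := ContinuousMap.starSubalgebra_topologicalClosure_eq_top_of_separatesPoints
    expAlgebra hsep
  have hle : ∀ f ∈ expAlgebra, f ∈ zonalSpan.topologicalClosure := by
    intro f hf
    have hf' : f ∈ Subalgebra.toSubmodule (Algebra.adjoin ℂ (expMonoid : Set C(Sphere, ℂ))) := hf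
    rw [Algebra.adjoin_eq_span, Submonoid.closure_eq] at hf'
    refine Submodule.span_le.2 ?_ hf'
    rintro _ ⟨v, rfl⟩
    exact exp_linearForm_mem_closure v
  rw [eq_top_iff]
  intro f _
  have hf : f ∈ expAlgebra.topologicalClosure := by rw [htop]; trivial
  exact closure_minimal hle zonalSpan.isClosed_topologicalClosure hf

/-- The zonal kernel as an element of the Hilbert space. -/
def zonalL2 (ℓ : ℕ) (ζ : Sphere) : SphereL2 :=
  ContinuousMap.toLp 2 sphereMeasure ℂ (zonalKernel ℓ ζ)

theorem span_zonalL2_topologicalClosure :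
    (Submodule.span ℂ (Set.range fun i : ℕ × Sphere => zonalL2 i.1 i.2)).topologicalClosure
      = ⊤ := by
  set T : C(Sphere, ℂ) →L[ℂ] SphereL2 := ContinuousMap.toLp 2 sphereMeasure ℂ
  have hr : DenseRange T := ContinuousMap.toLp_denseRange ℂ sphereMeasure ℂ (by simp)
  have hd : Dense (zonalSpan : Set C(Sphere, ℂ)) :=
    Submodule.dense_iff_topologicalClosure_eq_top.2 zonalSpan_topologicalClosure
  have h := hr.dense_image T.continuous hd
  rw [← Submodule.dense_iff_topologicalClosure_eq_top]
  convert h using 1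
  have : (fun i : ℕ × Sphere => zonalL2 i.1 i.2) =
      T ∘ fun i : ℕ × Sphere => zonalKernel i.1 i.2 := rfl
  rw [this, Set.range_comp, zonalSpan]
  exact congrArg _ (Submodule.map_span T.toLinearMap _).symm

theorem inner_zonalL2 (m n : ℕ) (ξ ζ : Sphere) :
    inner ℂ (zonalL2 m ξ) (zonalL2 n ζ) = if m = n then ((legendreL n ⟪ξ,ζ⟫ : ℝ) : ℂ) else 0 := by
  rw [zonalL2, zonalL2, ContinuousMap.inner_toLp]
  have h : ∀ η : Sphere, zonalKernel n ζ η * (starRingEnd ℂ) (zonalKernel m ξ η) =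
      ((legendreL m ⟪η,ξ⟫ * legendreL n ⟪η,ζ⟫ : ℝ) : ℂ) := fun η => by
    simp [zonalKernel, mul_comm]
  simp only [h]
  rw [integral_complex_ofReal, integral_legendreL_mul_legendreL]
  split_ifs <;> simp

/-! ### Frames with a diagonal frame operator -/

section Hilbert

universe u

variable {H : Type u} {ι : Type*} [NormedAddCommGroup H] [InnerProductSpace ℂ H]

/-- The synthesis operator of a frame is bounded by the square root of the upper frame bound,
by duality. -/
theorem IsFrame.norm_sum_smul_sq_le {f : ι → H} {A B : ℝ} (hf : IsFrame f A B) (s : Finset ι)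
    (c : ι → ℂ) : ‖∑ n ∈ s, c n • f n‖ ^ 2 ≤ B * ∑ n ∈ s, ‖c n‖ ^ 2 := by
  obtain ⟨-, hB, hf⟩ := hf
  set y := ∑ n ∈ s, c n • f n with hy
  have h1 : ‖y‖ ^ 2 ≤ ∑ n ∈ s, ‖c n‖ * ‖inner ℂ (f n) y‖ := by
    have : (inner ℂ y y : ℂ) = ∑ n ∈ s, (starRingEnd ℂ) (c n) * inner ℂ (f n) y := by
      conv_lhs => enter [2]; rw [hy]
      rw [sum_inner]
      simp only [inner_smul_left]
    have h2 : ‖(inner ℂ y y : ℂ)‖ = ‖y‖ ^ 2 := by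
      rw [inner_self_eq_norm_sq_to_K, norm_pow]; simp
    rw [← h2, this]
    refine (norm_sum_le _ _).trans (Finset.sum_le_sum fun n _ => ?_)
    rw [norm_mul, RCLike.norm_conj]
  have h2 : ∑ n ∈ s, ‖inner ℂ (f n) y‖ ^ 2 ≤ B * ‖y‖ ^ 2 :=
    ((hf y).1.sum_le_tsum s fun _ _ => sq_nonneg _).trans (hf y).2.2
  have h3 : (‖y‖ ^ 2) ^ 2 ≤ (∑ n ∈ s, ‖c n‖ ^ 2) * (B * ‖y‖ ^ 2) :=
    (pow_le_pow_left₀ (sq_nonneg _) h1 2).trans ((Finset.sum_mul_sq_le_sq_mul_sq _ _ _).trans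
      (mul_le_mul_of_nonneg_left h2 (Finset.sum_nonneg fun _ _ => sq_nonneg _)))
  have hc := Finset.sum_nonneg (s := s) fun n _ => sq_nonneg ‖c n‖
  rcases eq_or_ne y 0 with h0 | h0
  · rw [h0, norm_zero, zero_pow two_ne_zero]
    exact mul_nonneg hB.le hc
  · have h4 : 0 < ‖y‖ ^ 2 := by positivity
    nlinarith

/-- The frame operator of a frame is well defined and bounded. -/
theorem IsFrame.exists_frameOperator [CompleteSpace H] {f : ι → H} {A B : ℝ}
    (hf : IsFrame f A B) :
    ∃ S : H →L[ℂ] H, ∀ g, HasSum (fun n => inner ℂ (f n) g • f n) (S g) := by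
  have hB := hf.2.1
  have hs : ∀ g, Summable fun n => inner ℂ (f n) g • f n := by
    intro g
    rw [summable_iff_vanishing_norm]
    intro ε hε
    obtain ⟨s, hs⟩ := summable_iff_vanishing_norm.1 (hf.2.2 g).1 (ε ^ 2 / B) (by positivity)
    refine ⟨s, fun t ht => ?_⟩
    have h1 := hs t ht
    rw [Real.norm_of_nonneg (Finset.sum_nonneg fun _ _ => sq_nonneg _), lt_div_iff₀ hB] at h1
    have h2 := hf.norm_sum_smul_sq_le t fun n => inner ℂ (f n) g
    exact lt_of_pow_lt_pow_left₀ 2 hε.le (by linarith)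
  refine ⟨LinearMap.mkContinuous
    { toFun := fun g => ∑' n, inner ℂ (f n) g • f n
      map_add' := fun g g' => by
        simp only [inner_add_right, add_smul]
        exact (hs g).tsum_add (hs g')
      map_smul' := fun c g => by
        simp only [inner_smul_right, mul_smul]
        exact (hs g).tsum_const_smul c } B fun g => ?_, fun g => (hs g).hasSum⟩
  refine le_of_tendsto (hs g).hasSum.norm (.of_forall fun s => ?_)
  refine le_of_sq_le_sq ?_ (by positivity)
  calc _ ≤ B * ∑ n ∈ s, ‖inner ℂ (f n) g‖ ^ 2 := hf.norm_sum_smul_sq_le s _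
    _ ≤ B * (B * ‖g‖ ^ 2) := mul_le_mul_of_nonneg_left
        (((hf.2.2 g).1.sum_le_tsum s fun _ _ => sq_nonneg _).trans (hf.2.2 g).2.2) hB.le
    _ = (B * ‖g‖) ^ 2 := by ring

/-- A total family of vectors sorted into pairwise orthogonal classes `z ℓ` gives rise to a
Hilbert basis each of whose vectors belongs to the closed span of one of the classes. -/
theorem exists_hilbertBasis_of_orthogonal_classes [CompleteSpace H] {κ : Type*} {z : ℕ → κ → H}
    (horth : ∀ m n, m ≠ n → ∀ x y, inner ℂ (z m x) (z n y) = 0)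
    (htot : (Submodule.span ℂ (Set.range fun i : ℕ × κ => z i.1 i.2)).topologicalClosure = ⊤) :
    ∃ (α : Type u) (e : HilbertBasis α ℂ H) (deg : α → ℕ), ∀ a,
      e a ∈ (Submodule.span ℂ (Set.range (z (deg a)))).topologicalClosure := by
  set V : ℕ → Submodule ℂ H := fun ℓ => (Submodule.span ℂ (Set.range (z ℓ))).topologicalClosure
    with hV
  have hVc : ∀ ℓ, CompleteSpace (V ℓ) := fun ℓ =>
    (Submodule.isClosed_topologicalClosure _).completeSpace_coe
  have hVo : OrthogonalFamily ℂ (fun ℓ => V ℓ) fun ℓ => (V ℓ).subtypeₗᵢ := by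
    refine OrthogonalFamily.of_pairwise fun m n hmn => ?_
    have h1 : Submodule.span ℂ (Set.range (z m)) ⟂ Submodule.span ℂ (Set.range (z n)) := by
      rw [Submodule.isOrtho_span]
      rintro _ ⟨x, rfl⟩ _ ⟨y, rfl⟩
      exact horth m n hmn x y
    have h2 : V m ≤ (Submodule.span ℂ (Set.range (z n)))ᗮ :=
      Submodule.topologicalClosure_minimal _ h1 (Submodule.isClosed_orthogonal _)
    have h3 : V n ≤ (V m)ᗮ :=
      Submodule.topologicalClosure_minimal _ (Submodule.IsOrtho.symm h2)
        (Submodule.isClosed_orthogonal _)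
    exact Submodule.IsOrtho.symm h3
  choose w e he using fun ℓ => exists_hilbertBasis ℂ (V ℓ)
  have ho := hVo.orthonormal_sigma_orthonormal (v_family := fun ℓ => ⇑(e ℓ))
    fun ℓ => (e ℓ).orthonormal
  have hdense : (⊤ : Submodule ℂ H) ≤ (Submodule.span ℂ (Set.range fun a : Σ ℓ, w ℓ =>
      (V a.1).subtypeₗᵢ (e a.1 a.2))).topologicalClosure := by
    rw [← htot]
    refine Submodule.topologicalClosure_minimal _ (Submodule.span_le.2 ?_)
      (Submodule.isClosed_topologicalClosure _)
    rintro _ ⟨⟨ℓ, x⟩, rfl⟩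
    have hx : z ℓ x ∈ V ℓ := Submodule.le_topologicalClosure _ (Submodule.subset_span ⟨x, rfl⟩)
    have h1 : (⟨z ℓ x, hx⟩ : V ℓ) ∈ (Submodule.span ℂ (Set.range (e ℓ))).topologicalClosure := by
      rw [(e ℓ).dense_span]; trivial
    have h2 := image_closure_subset_closure_image (V ℓ).subtypeL.continuous
      (Set.mem_image_of_mem _ h1)
    refine closure_mono ?_ h2
    rintro _ ⟨y, hy, rfl⟩
    induction hy using Submodule.span_induction with
    | mem y hy =>
      obtain ⟨a, rfl⟩ := hy
      exact Submodule.subset_span ⟨⟨ℓ, a⟩, rfl⟩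
    | zero => simp
    | add y y' _ _ h h' => simpa using add_mem h h'
    | smul c y _ h => simpa using Submodule.smul_mem _ c h
  refine ⟨Σ ℓ, w ℓ, HilbertBasis.mk ho hdense, Sigma.fst, fun a => ?_⟩
  rw [HilbertBasis.coe_mk]
  exact (e a.1 a.2).2

variable {J : Type*} {K : J → Type*} [∀ j, Fintype (K j)] {κ : Type*}

/-- Suppose that for every `j` the partial frame operator of `(f ⟨j, k⟩)_k` has the vectors
`z ℓ x` as eigenvectors with eigenvalues `c j ℓ ≥ 0`. Then the sums `∑ j, c j ℓ` control the
frame bounds of `f`, as one sees by expanding in a Hilbert basis of eigenvectors. -/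
theorem isFrame_of_eigenvectors [CompleteSpace H] {z : ℕ → κ → H}
    (horth : ∀ m n, m ≠ n → ∀ x y, inner ℂ (z m x) (z n y) = 0)
    (htot : (Submodule.span ℂ (Set.range fun i : ℕ × κ => z i.1 i.2)).topologicalClosure = ⊤)
    {f : (Σ j, K j) → H} {c : J → ℕ → ℝ} (hc : ∀ j ℓ, 0 ≤ c j ℓ)
    (hf : ∀ j ℓ x, ∑ k, inner ℂ (f ⟨j, k⟩) (z ℓ x) • f ⟨j, k⟩ = (c j ℓ : ℂ) • z ℓ x)
    {σ : ℕ → ℝ} (hσ : ∀ ℓ, HasSum (fun j => c j ℓ) (σ ℓ)) {A B : ℝ} (hA : 0 < A) (hB : 0 < B)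
    (hAσ : ∀ ℓ, A ≤ σ ℓ) (hσB : ∀ ℓ, σ ℓ ≤ B) : IsFrame f A B := by
  obtain ⟨α, e, deg, he⟩ := exists_hilbertBasis_of_orthogonal_classes horth htot
  -- the partial frame operators
  let T : J → H →L[ℂ] H := fun j => ∑ k, (innerSL ℂ (f ⟨j, k⟩)).smulRight (f ⟨j, k⟩)
  have hT : ∀ j g, T j g = ∑ k, inner ℂ (f ⟨j, k⟩) g • f ⟨j, k⟩ := fun j g => by
    simp [T]
  have hTe : ∀ j a, T j (e a) = (c j (deg a) : ℂ) • e a := by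
    intro j a
    let D : H →L[ℂ] H := T j - (c j (deg a) : ℂ) • ContinuousLinearMap.id ℂ H
    have hD : (Submodule.span ℂ (Set.range (z (deg a)))).topologicalClosure ≤ D.ker := by
      refine Submodule.topologicalClosure_minimal _ (Submodule.span_le.2 ?_) D.isClosed_ker
      rintro _ ⟨x, rfl⟩
      simp [D, hT, hf]
    have : D (e a) = 0 := hD (he a)
    exact sub_eq_zero.1 this
  have hTs : ∀ j x y, inner ℂ x (T j y) = inner ℂ (T j x) y := by
    intro j x y
    simp only [hT, inner_sum, sum_inner, inner_smul_left, inner_smul_right, inner_conj_symm]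
    exact Finset.sum_congr rfl fun k _ => mul_comm _ _
  have hexp : ∀ g j, HasSum (fun a => c j (deg a) * ‖inner ℂ (e a) g‖ ^ 2)
      (∑ k, ‖inner ℂ (f ⟨j, k⟩) g‖ ^ 2) := by
    intro g j
    have h1 := e.hasSum_inner_mul_inner g (T j g)
    have h2 : inner ℂ g (T j g) = ((∑ k, ‖inner ℂ (f ⟨j, k⟩) g‖ ^ 2 : ℝ) : ℂ) := by
      simp only [hT, inner_sum, inner_smul_right]
      push_cast
      refine Finset.sum_congr rfl fun k _ => ?_
      rw [← inner_conj_symm g, Complex.mul_conj, Complex.normSq_eq_norm_sq]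
      push_cast; rfl
    have h3 : ∀ a, inner ℂ g (e a) * inner ℂ (e a) (T j g) =
        ((c j (deg a) * ‖inner ℂ (e a) g‖ ^ 2 : ℝ) : ℂ) := by
      intro a
      rw [hTs, hTe, inner_smul_left, Complex.conj_ofReal, ← inner_conj_symm g]
      have := Complex.mul_conj (inner ℂ (e a) g)
      rw [Complex.normSq_eq_norm_sq] at this
      push_cast at this ⊢
      linear_combination (c j (deg a) : ℂ) * this
    simp only [h2, h3] at h1
    exact_mod_cast h1
  refine ⟨hA, hB, fun g => ?_⟩
  have hpars : HasSum (fun a => ‖inner ℂ (e a) g‖ ^ 2) (‖g‖ ^ 2) := by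
    have h1 := e.hasSum_inner_mul_inner g g
    have h3 : ∀ a, inner ℂ g (e a) * inner ℂ (e a) g = ((‖inner ℂ (e a) g‖ ^ 2 : ℝ) : ℂ) := by
      intro a
      rw [← inner_conj_symm g, mul_comm, Complex.mul_conj, Complex.normSq_eq_norm_sq]
    have h4 : inner ℂ g g = ((‖g‖ ^ 2 : ℝ) : ℂ) := by
      rw [inner_self_eq_norm_sq_to_K]; push_cast; rfl
    simp only [h3, h4] at h1
    exact_mod_cast h1
  -- both iterated sums of the nonnegative array `c j (deg a) * |⟨g, e a⟩|²` are computed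
  let F : α × J → ℝ := fun p => c p.2 (deg p.1) * ‖inner ℂ (e p.1) g‖ ^ 2
  have hfib : ∀ a, HasSum (fun j => F (a, j)) (σ (deg a) * ‖inner ℂ (e a) g‖ ^ 2) :=
    fun a => (hσ (deg a)).mul_right _
  have hF0 : 0 ≤ F := fun p => mul_nonneg (hc _ _) (sq_nonneg _)
  have hσs : Summable fun a => σ (deg a) * ‖inner ℂ (e a) g‖ ^ 2 :=
    (hpars.summable.mul_left B).of_nonneg_of_le
      (fun a => mul_nonneg (hA.le.trans (hAσ _)) (sq_nonneg _))
      (fun a => mul_le_mul_of_nonneg_right (hσB _) (sq_nonneg _))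
  have hF : Summable F := (summable_prod_of_nonneg hF0).2
    ⟨fun a => (hfib a).summable, by simpa only [(hfib _).tsum_eq] using hσs⟩
  have ht1 := hF.hasSum.prod_fiberwise hfib
  have ht2 : HasSum (fun j => ∑ k, ‖inner ℂ (f ⟨j, k⟩) g‖ ^ 2) (∑' p, F p) :=
    ((Equiv.prodComm J α).hasSum_iff.2 hF.hasSum).prod_fiberwise (hexp g)
  have hs : Summable fun i : Σ j, K j => ‖inner ℂ (f i) g‖ ^ 2 := by
    refine (summable_sigma_of_nonneg fun _ => sq_nonneg _).2
      ⟨fun j => (hasSum_fintype _).summable, ?_⟩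
    simpa only [tsum_fintype] using ht2.summable
  have ht : ∑' i, ‖inner ℂ (f i) g‖ ^ 2 = ∑' p, F p :=
    (hs.hasSum.sigma fun j => hasSum_fintype _).unique ht2
  refine ⟨hs, ?_, ?_⟩
  · rw [ht]
    exact hasSum_le (fun a => mul_le_mul_of_nonneg_right (hAσ _) (sq_nonneg _))
      (hpars.mul_left A) ht1
  · rw [ht]
    exact hasSum_le (fun a => mul_le_mul_of_nonneg_right (hσB _) (sq_nonneg _))
      ht1 (hpars.mul_left B)

/-- Under the assumptions of `isFrame_of_eigenvectors`, the vectors `z ℓ x` are eigenvectors of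
the frame operator with eigenvalues `∑ j, c j ℓ`. -/
theorem frameOperator_eigenvector {z : ℕ → κ → H} {f : (Σ j, K j) → H} {c : J → ℕ → ℝ}
    (hf : ∀ j ℓ x, ∑ k, inner ℂ (f ⟨j, k⟩) (z ℓ x) • f ⟨j, k⟩ = (c j ℓ : ℂ) • z ℓ x)
    {σ : ℕ → ℝ} (hσ : ∀ ℓ, HasSum (fun j => c j ℓ) (σ ℓ)) {S : H →L[ℂ] H}
    (hS : ∀ g, HasSum (fun n => inner ℂ (f n) g • f n) (S g)) (ℓ : ℕ) (x : κ) :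
    S (z ℓ x) = (σ ℓ : ℂ) • z ℓ x := by
  have h1 := (hS (z ℓ x)).sigma fun j => hasSum_fintype _
  simp only [hf] at h1
  have h2 : HasSum (fun j => (c j ℓ : ℂ)) (σ ℓ : ℂ) := Complex.hasSum_ofReal.2 (hσ ℓ)
  exact h1.unique (h2.smul_const (z ℓ x))

end Hilbert

/-! ### Needlets -/

section Needlets

theorem needletL2_eq_sum (d : ℕ) (b : ℕ → ℝ) (w : ℝ) (η : Sphere) :
    needletL2 d b w η =
      ∑ ℓ ∈ Finset.range (d + 1), ((√w * b ℓ : ℝ) : ℂ) • zonalL2 ℓ η := by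
  have h : needletFun d b w η =
      ∑ ℓ ∈ Finset.range (d + 1), ((√w * b ℓ : ℝ) : ℂ) • zonalKernel ℓ η := by
    ext ξ
    rw [ContinuousMap.sum_apply]
    simp [needletFun, zonalKernel, Finset.mul_sum, mul_assoc]
  simp only [needletL2, h, map_sum, map_smul, zonalL2]

theorem inner_needletL2_zonalL2 {d : ℕ} {b : ℕ → ℝ} (hb : ∀ ℓ, d < ℓ → b ℓ = 0) (w : ℝ)
    (η : Sphere) (m : ℕ) (ζ : Sphere) :
    inner ℂ (needletL2 d b w η) (zonalL2 m ζ) = ((√w * b m * legendreL m ⟪η,ζ⟫ : ℝ) : ℂ) := by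
  rw [needletL2_eq_sum, sum_inner]
  simp only [inner_smul_left, inner_zonalL2, Complex.conj_ofReal, mul_ite, mul_zero]
  rw [Finset.sum_ite_eq']
  split_ifs with h
  · push_cast; ring
  · rw [Finset.mem_range, not_lt] at h
    simp [hb m (by omega)]

/-- For one window `b`, the zonal kernels of degree `m` are eigenvectors, with eigenvalue
`(b m)²`, of the frame operator of the needlets: this is where the quadrature formula enters. -/
theorem sum_inner_needletL2_smul {K : Type*} [Fintype K] {ξ : K → Sphere} {w : K → ℝ} {d : ℕ}
    (hw : ∀ k, 0 < w k) (hq : IsExactQuadrature ξ w (2 * d)) {b : ℕ → ℝ}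
    (hb : ∀ ℓ, d < ℓ → b ℓ = 0) (m : ℕ) (ζ : Sphere) :
    ∑ k, inner ℂ (needletL2 d b (w k) (ξ k)) (zonalL2 m ζ) • needletL2 d b (w k) (ξ k) =
      ((b m ^ 2 : ℝ) : ℂ) • zonalL2 m ζ := by
  simp only [inner_needletL2_zonalL2 hb]
  rcases lt_or_ge d m with hm | hm
  · simp [hb m hm]
  have h : ∑ k, ((√(w k) * b m * legendreL m ⟪ξ k,ζ⟫ : ℝ) : ℂ) • needletFun d b (w k) (ξ k) =
      ((b m ^ 2 : ℝ) : ℂ) • zonalKernel m ζ := by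
    ext η
    rw [ContinuousMap.sum_apply]
    have h1 : ∀ k, (√(w k) * b m * legendreL m ⟪ξ k,ζ⟫) * (√(w k) *
        ∑ ℓ ∈ Finset.range (d + 1), b ℓ * legendreL ℓ ⟪η,ξ k⟫) =
        b m * ∑ ℓ ∈ Finset.range (d + 1), b ℓ *
          (w k * (legendreL ℓ ⟪ξ k,η⟫ * legendreL m ⟪ξ k,ζ⟫)) := by
      intro k
      have hs := Real.mul_self_sqrt (hw k).le
      simp only [Finset.mul_sum]
      refine Finset.sum_congr rfl fun ℓ _ => ?_
      rw [real_inner_comm (ξ k).1 η.1]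
      linear_combination (b m * legendreL m ⟪ξ k,ζ⟫ * b ℓ * legendreL ℓ ⟪ξ k,η⟫) * hs
    have h2 : ∑ k, (√(w k) * b m * legendreL m ⟪ξ k,ζ⟫) * (√(w k) *
        ∑ ℓ ∈ Finset.range (d + 1), b ℓ * legendreL ℓ ⟪η,ξ k⟫) =
        b m ^ 2 * legendreL m ⟪η,ζ⟫ := by
      simp only [h1]
      rw [← Finset.mul_sum, Finset.sum_comm]
      simp only [← Finset.mul_sum]
      rw [Finset.sum_congr rfl fun ℓ hℓ => by
        rw [hq.sum_legendreL_mul_legendreL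
          (by have := Finset.mem_range.1 hℓ; omega : ℓ + m ≤ 2 * d) η ζ]]
      simp only [mul_ite, mul_zero]
      rw [Finset.sum_ite_eq', if_pos (Finset.mem_range.2 (by omega))]
      ring
    have h3 := congrArg (fun r : ℝ => (r : ℂ)) h2
    simp only [Complex.ofReal_sum, Complex.ofReal_mul] at h3
    simpa [needletFun, zonalKernel] using h3
  have h' := congrArg (ContinuousMap.toLp 2 sphereMeasure ℂ) h
  simp only [map_sum, map_smul] at h'
  exact h'

theorem eq_zero_of_bandLimit_lt {b : ℕ → ℝ} (hb : (Function.support b).Finite) {ℓ : ℕ}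
    (h : bandLimit b < ℓ) : b ℓ = 0 := by
  by_contra h0
  exact absurd h (not_lt.2 (le_csSup hb.bddAbove h0))

end Needlets

end Needlet

end

theorem proposition2 {J : Type*} [Countable J] {K : J → Type*} [∀ j, Fintype (K j)]
    (b : J → ℕ → ℝ) (hfin : ∀ j, (Function.support (b j)).Finite)
    (C₁ C₂ : ℝ) (hC₁ : 0 < C₁) (hC₂ : 0 < C₂)
    (hb : ∀ ℓ : ℕ, Summable (fun j => |b j ℓ| ^ 2) ∧
      C₁ ≤ ∑' j, |b j ℓ| ^ 2 ∧ ∑' j, |b j ℓ| ^ 2 ≤ C₂)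
    (ξ : ∀ j, K j → Needlet.Sphere) (w : ∀ j, K j → ℝ)
    (hpos : ∀ j k, 0 < w j k)
    (hquad : ∀ j, Needlet.IsExactQuadrature (ξ j) (w j) (2 * Needlet.bandLimit (b j))) :
    Needlet.IsFrame (Needlet.needlet b ξ w) C₁ C₂ ∧
    Needlet.IsDualFrame (Needlet.needlet b ξ w) (Needlet.reconstructionNeedlet b ξ w) ∧
    ∀ F : Needlet.SphereL2,
      HasSum (fun i => inner ℂ (Needlet.needlet b ξ w i) F •
        Needlet.reconstructionNeedlet b ξ w i) F ∧
      HasSum (fun i => inner ℂ (Needlet.needlet b ξ w i) F *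
        (starRingEnd ℂ) (inner ℂ (Needlet.reconstructionNeedlet b ξ w i) F))
        ((‖F‖ ^ 2 : ℝ) : ℂ) := by
  open Needlet in
  simp only [sq_abs] at hb
  set σ : ℕ → ℝ := fun ℓ => ∑' j, b j ℓ ^ 2 with hσdef
  have hσ0 : ∀ ℓ, 0 < σ ℓ := fun ℓ => hC₁.trans_le (hb ℓ).2.1
  have hσ : ∀ ℓ, HasSum (fun j => b j ℓ ^ 2) (σ ℓ) := fun ℓ => (hb ℓ).1.hasSum
  have hsw : ∀ j ℓ, synthesisWindow b j ℓ = b j ℓ / σ ℓ := fun _ _ => rfl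
  -- the squares of the synthesis windows add up to `∑ j, b² / σ² = 1 / σ`
  have hσ' : ∀ ℓ, HasSum (fun j => synthesisWindow b j ℓ ^ 2) (σ ℓ)⁻¹ := by
    intro ℓ
    have h := (hσ ℓ).div_const (σ ℓ ^ 2)
    rw [show σ ℓ / σ ℓ ^ 2 = (σ ℓ)⁻¹ by have := (hσ0 ℓ).ne'; field_simp] at h
    simpa only [hsw, div_pow] using h
  have hsupp : ∀ j ℓ, bandLimit (b j) < ℓ → b j ℓ = 0 :=
    fun j ℓ => eq_zero_of_bandLimit_lt (hfin j)
  have hsupp' : ∀ j ℓ, bandLimit (b j) < ℓ → synthesisWindow b j ℓ = 0 := fun j ℓ h => by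
    rw [hsw, hsupp j ℓ h, zero_div]
  have horth : ∀ m n, m ≠ n → ∀ x y, inner ℂ (zonalL2 m x) (zonalL2 n y) = 0 :=
    fun m n hmn x y => by rw [inner_zonalL2, if_neg hmn]
  have htot := span_zonalL2_topologicalClosure
  have hf : ∀ j ℓ x, ∑ k, inner ℂ (needlet b ξ w ⟨j, k⟩) (zonalL2 ℓ x) • needlet b ξ w ⟨j, k⟩ =
      ((b j ℓ ^ 2 : ℝ) : ℂ) • zonalL2 ℓ x :=
    fun j ℓ x => sum_inner_needletL2_smul (hpos j) (hquad j) (hsupp j) ℓ x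
  have hg : ∀ j ℓ x, ∑ k, inner ℂ (reconstructionNeedlet b ξ w ⟨j, k⟩) (zonalL2 ℓ x) •
      reconstructionNeedlet b ξ w ⟨j, k⟩ = ((synthesisWindow b j ℓ ^ 2 : ℝ) : ℂ) • zonalL2 ℓ x :=
    fun j ℓ x => sum_inner_needletL2_smul (hpos j) (hquad j) (hsupp' j) ℓ x
  have hF : IsFrame (needlet b ξ w) C₁ C₂ :=
    isFrame_of_eigenvectors horth htot (fun _ _ => sq_nonneg _) hf hσ hC₁ hC₂
      (fun ℓ => (hb ℓ).2.1) (fun ℓ => (hb ℓ).2.2)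
  have hG : IsFrame (reconstructionNeedlet b ξ w) C₂⁻¹ C₁⁻¹ :=
    isFrame_of_eigenvectors horth htot (fun _ _ => sq_nonneg _) hg hσ' (inv_pos.2 hC₂)
      (inv_pos.2 hC₁) (fun ℓ => inv_anti₀ (hσ0 ℓ) (hb ℓ).2.2) (fun ℓ => inv_anti₀ hC₁ (hb ℓ).2.1)
  obtain ⟨S, hS⟩ := hF.exists_frameOperator
  obtain ⟨R, hR⟩ := hG.exists_frameOperator
  have hSz := frameOperator_eigenvector hf hσ hS
  have hRz := frameOperator_eigenvector hg hσ' hR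
  have hdense : Dense (Submodule.span ℂ
      (Set.range fun i : ℕ × Sphere => zonalL2 i.1 i.2) : Set SphereL2) :=
    Submodule.dense_iff_topologicalClosure_eq_top.2 htot
  have hcancel : ∀ ℓ, (σ ℓ : ℂ) ≠ 0 := fun ℓ => Complex.ofReal_ne_zero.2 (hσ0 ℓ).ne'
  have hRS : R.comp S = ContinuousLinearMap.id ℂ SphereL2 := by
    refine ContinuousLinearMap.ext_on hdense ?_
    rintro _ ⟨⟨ℓ, x⟩, rfl⟩
    change R (S (zonalL2 ℓ x)) = zonalL2 ℓ x
    rw [hSz, map_smul, hRz, smul_smul, Complex.ofReal_inv, mul_inv_cancel₀ (hcancel ℓ), one_smul]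
  have hSR : S.comp R = ContinuousLinearMap.id ℂ SphereL2 := by
    refine ContinuousLinearMap.ext_on hdense ?_
    rintro _ ⟨⟨ℓ, x⟩, rfl⟩
    change S (R (zonalL2 ℓ x)) = zonalL2 ℓ x
    rw [hRz, map_smul, hSz, smul_smul, Complex.ofReal_inv, inv_mul_cancel₀ (hcancel ℓ), one_smul]
  have hRf : ∀ i, reconstructionNeedlet b ξ w i = R (needlet b ξ w i) := by
    intro i
    rw [reconstructionNeedlet, needlet, needletL2_eq_sum, needletL2_eq_sum, map_sum]
    refine Finset.sum_congr rfl fun ℓ _ => ?_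
    rw [map_smul, hRz, smul_smul, hsw]
    congr 1
    push_cast
    ring
  have hsum : ∀ F : SphereL2, HasSum (fun i => inner ℂ (needlet b ξ w i) F •
      reconstructionNeedlet b ξ w i) F := by
    intro F
    have h := (hS F).mapL R
    have hF : R (S F) = F := congrArg (fun T : SphereL2 →L[ℂ] SphereL2 => T F) hRS
    simpa only [map_smul, ← hRf, hF] using h
  refine ⟨hF, ⟨ContinuousLinearEquiv.equivOfInverse S R
    (fun x => congrArg (fun T : SphereL2 →L[ℂ] SphereL2 => T x) hRS)
    (fun x => congrArg (fun T : SphereL2 →L[ℂ] SphereL2 => T x) hSR), hS, hRf⟩,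
    fun F => ⟨hsum F, ?_⟩⟩
  have h := (hsum F).mapL (innerSL ℂ F)
  simp only [innerSL_apply_apply, inner_smul_right, inner_self_eq_norm_sq_to_K] at h
  simp only [inner_conj_symm, Complex.ofReal_pow]
  exact h
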